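/- **Definitions.** For ordinals, $[X]^{<\omega}$ is the set of finite subsets of $X$; $C\sqsubseteq D$ means that $C$ is an initial segment of $D$; $A<B$ means $a<b$ for all $a\in A$, $b\in B$. In a well-founded order, $\mathrm{rank}(x)=\sup\{\mathrm{rank}(y)+1 : y<x\}$; $X_\alpha$ is the set of elements of rank $\alpha$ and $Ht(X)$ is the least $\alpha$ with $X_\alpha=\emptyset$. A *type* is a sequence $\{(m_k,n_{k+1},r_{k+1})\}_{k\in\omega}$ of triples of natural numbers with $m_0=1$; $n_{k+1}\ge 2$, $m_k>r_{k+1}$ and $m_{k+1}=r_{k+1}+(m_k-r_{k+1})n_{k+1}$ for all $k\in\omega$; and such that every $r\in\omega$ equals $r_k$ for infinitely many $k$. A *construction scheme* over $\omega_1$ of this type is a family $\mathcal F\subseteq[\omega_1]^{<\omega}$, cofinal in $[\omega_1]^{<\omega}$, such that for all $k\in\omega$ (with $\mathcal F_k$ the set of members of rank $k$ in $(\mathcal F,\subsetneq)$): $|F|=m_k$ for $F\in\mathcal F_k$; $E\cap F\sqsubseteq E$ and $E\cap F\sqsubseteq F$ for $E,F\in\mathcal F_k$; and every $F\in\mathcal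 F_{k+1}$ is the union of uniquely determined $F_0,\dots,F_{n_{k+1}-1}\in\mathcal F_k$, which form a $\Delta$-system with a root $R(F)$ of size $r_{k+1}$ and $R(F)<F_0\setminus R(F)<\dots<F_{n_{k+1}-1}\setminus R(F)$. A set $F\in\mathcal F_l$ ($l\ge1$) *fully captures* $\{c_i\}_{i<n_l}\subseteq[\omega_1]^{<\omega}$ if for each $i<n_l$: $c_i\subseteq F_i$, $c_i\setminus R(F)\neq\emptyset$, and the increasing bijection from $F_0$ to $F_i$ maps $c_0$ onto $c_i$. The scheme $\mathcal F$ is *fully capturing* if for every uncountable $S\subseteq[\omega_1]^{<\omega}$ and every $k\in\omega$ there are $l>k$ and $F\in\mathcal F_l$ such that $F$ fully captures some $\{c_i\}_{i<n_l}\subseteq S$. The *Fully Capturing Axiom* (FCA) says that for every type there is a fully capturing construction scheme over $\omega_1$ of that type. A *tree* is a partial order in which the set of predecessors of each element is well-ordered. An *$\omega_1$-tree* is a tree $T$ with $Ht(T)=\omega_1$ and $T_\alpha$ countable for all $\alpha<\omega_1$. It is *Suslin* if it has no uncountable chain and no uncountable antichain. For $t\in T$, $T|_t$ is the set of all elements of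 $T$ comparable with $t$. For $k\ge1$ and trees $T_0,\dots,T_{k-1}$, the tree product $\bigotimes_{i<k}T_i$ is the set of all $t\in\prod_{i<k}T_i$ with $\mathrm{rank}(t(0))=\mathrm{rank}(t(i))$ for all $i<k$, ordered by: $s<t$ if and only if $s(i)<t(i)$ for every $i<k$. **Theorem.** Assume FCA. Then there is a full Suslin tree, that is, an $\omega_1$-tree $T$ such that for every $k\ge1$ and all distinct $t_0,\dots,t_{k-1}\in T$ of the same rank, the tree product $\bigotimes_{i<k}T|_{t_i}$ is a Suslin tree. -/

import Mathlib

/-! ### Types and construction schemes -/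

/-- A type `{(m k, n (k+1), r (k+1))}` for construction schemes. The values `n 0` and `r 0`
carry no information and are never used. -/
structure SchemeType where
  m : ℕ → ℕ
  n : ℕ → ℕ
  r : ℕ → ℕ
  m_zero : m 0 = 1
  two_le_n : ∀ k, 2 ≤ n (k + 1)
  r_infinite : ∀ s, {k : ℕ | r (k + 1) = s}.Infinite
  r_lt_m : ∀ k, r (k + 1) < m k
  m_succ : ∀ k, m (k + 1) = r (k + 1) + (m k - r (k + 1)) * n (k + 1)

/-- `schemeLevel 𝓕 k` is `𝓕_k`: the members of `𝓕` whose rank in the well-founded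
order `(𝓕, ⊊)` is `k`. -/
def schemeLevel (𝓕 : Set (Finset Ordinal.{0})) (k : ℕ) : Set (Finset Ordinal.{0}) :=
  {F | ∃ h : F ∈ 𝓕, IsWellFounded.rank (fun A B : 𝓕 => A < B) ⟨F, h⟩ = (k : Ordinal)}

/-- `C ⊑ D`: `C` is an initial segment of `D`. -/
def InitSeg (C D : Finset Ordinal.{0}) : Prop :=
  C ⊆ D ∧ ∀ c ∈ C, ∀ d ∈ D, d ≤ c → d ∈ C

/-- `A < B`: every element of `A` is below every element of `B`. -/
def SetBelow (A B : Finset Ordinal.{0}) : Prop :=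
  ∀ a ∈ A, ∀ b ∈ B, a < b

/-- The sets `f i`, `i < n (k+1)`, are the canonical decomposition `F_0, …, F_{n (k+1) - 1}` of
`F ∈ 𝓕_{k+1}`, listed increasingly, and `R` is its root `R(F)`. -/
structure IsCanonicalDecomposition (τ : SchemeType) (𝓕 : Set (Finset Ordinal.{0})) (k : ℕ)
    (F : Finset Ordinal.{0}) (f : ℕ → Finset Ordinal.{0}) (R : Finset Ordinal.{0}) : Prop where
  mem_level : F ∈ schemeLevel 𝓕 (k + 1)
  piece_mem : ∀ i < τ.n (k + 1), f i ∈ schemeLevel 𝓕 k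
  union_eq : F = (Finset.range (τ.n (k + 1))).biUnion f
  unique : ∀ g : ℕ → Finset Ordinal.{0}, (∀ i < τ.n (k + 1), g i ∈ schemeLevel 𝓕 k) →
    F = (Finset.range (τ.n (k + 1))).biUnion g →
    (Finset.range (τ.n (k + 1))).image g = (Finset.range (τ.n (k + 1))).image f
  delta_system : ∀ i < τ.n (k + 1), ∀ j < τ.n (k + 1), i ≠ j → f i ∩ f j = R
  card_root : R.card = τ.r (k + 1)
  root_below : ∀ i < τ.n (k + 1), SetBelow R (f i \ R)
  pieces_below : ∀ i j, i < j → j < τ.n (k + 1) → SetBelow (f i \ R) (f j \ R)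

/-- `𝓕` is a construction scheme of type `τ` over the set of ordinals `X`. -/
structure IsConstructionScheme (τ : SchemeType) (X : Set Ordinal.{0})
    (𝓕 : Set (Finset Ordinal.{0})) : Prop where
  subset : ∀ F ∈ 𝓕, (F : Set Ordinal.{0}) ⊆ X
  cofinal : ∀ A : Finset Ordinal.{0}, (A : Set Ordinal.{0}) ⊆ X → ∃ F ∈ 𝓕, A ⊆ F
  card_eq : ∀ k, ∀ F ∈ schemeLevel 𝓕 k, F.card = τ.m k
  initSeg : ∀ k, ∀ F ∈ schemeLevel 𝓕 k, ∀ E ∈ schemeLevel 𝓕 k,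
    InitSeg (E ∩ F) E ∧ InitSeg (E ∩ F) F
  decomposition : ∀ k, ∀ F ∈ schemeLevel 𝓕 (k + 1), ∃ f R, IsCanonicalDecomposition τ 𝓕 k F f R

/-- `F ∈ 𝓕_{k+1}` captures the family `c 0, …, c (K-1)` of finite sets. The order isomorphism
`φ` between the finite sets of ordinals `F_0` and `F_i` is unique; it is the increasing
bijection, and the last clause says that it maps `c 0` onto `c i`. -/
def Captures (τ : SchemeType) (𝓕 : Set (Finset Ordinal.{0})) (k : ℕ)
    (F : Finset Ordinal.{0}) (K : ℕ) (c : ℕ → Finset Ordinal.{0}) : Prop :=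
  ∃ f R, IsCanonicalDecomposition τ 𝓕 k F f R ∧ K ≤ τ.n (k + 1) ∧
    (∀ i < K, c i ⊆ f i ∧ (c i \ R).Nonempty) ∧
    ∀ i < K, ∃ φ : {a // a ∈ f 0} ≃o {a // a ∈ f i},
      ∀ a : {a // a ∈ f 0}, (a : Ordinal.{0}) ∈ c 0 ↔ (φ a : Ordinal.{0}) ∈ c i

/-- `F ∈ 𝓕_{k+1}` fully captures `c 0, …, c (n (k+1) - 1)`. -/
def FullyCaptures (τ : SchemeType) (𝓕 : Set (Finset Ordinal.{0})) (k : ℕ)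
    (F : Finset Ordinal.{0}) (c : ℕ → Finset Ordinal.{0}) : Prop :=
  Captures τ 𝓕 k F (τ.n (k + 1)) c

/-- The scheme `𝓕` (over `ω₁`) is fully capturing. -/
def FullyCapturing (τ : SchemeType) (𝓕 : Set (Finset Ordinal.{0})) : Prop :=
  ∀ S : Set (Finset Ordinal.{0}),
    (∀ s ∈ S, (s : Set Ordinal.{0}) ⊆ Set.Iio (Ordinal.omega 1)) → ¬ S.Countable →
    ∀ k : ℕ, ∃ l, k < l + 1 ∧ ∃ F ∈ schemeLevel 𝓕 (l + 1), ∃ c : ℕ → Finset Ordinal.{0},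
      (∀ i < τ.n (l + 1), c i ∈ S) ∧ FullyCaptures τ 𝓕 l F c

/-- The Fully Capturing Axiom: for every type there is a fully capturing construction scheme
over `ω₁` of that type. -/
def FCA : Prop :=
  ∀ τ : SchemeType, ∃ 𝓕 : Set (Finset Ordinal.{0}),
    IsConstructionScheme τ (Set.Iio (Ordinal.omega 1)) 𝓕 ∧ FullyCapturing τ 𝓕

/-! ### Trees -/

universe u

/-- A partial order is a tree if the predecessors of each element are well-ordered. -/
def IsTreeOrder (T : Type u) [PartialOrder T] : Prop :=
  ∀ t : T, IsWellOrder (Set.Iio t) (fun x y => x < y)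

theorem IsTreeOrder.wf {T : Type u} [PartialOrder T] (hT : IsTreeOrder T) :
    WellFounded (fun x y : T => x < y) := by
  refine ⟨fun t => ⟨t, fun y hy => ?_⟩⟩
  have key : ∀ z : Set.Iio t, Acc (fun x y : T => x < y) (z : T) := by
    intro z
    induction (hT t).toIsWellFounded.wf.apply z with
    | intro z _ ih =>
      exact ⟨_, fun w hw => ih ⟨w, lt_trans hw z.2⟩ hw⟩
  exact key ⟨y, hy⟩

/-- `rank t = sup {rank s + 1 | s < t}`. -/
noncomputable def IsTreeOrder.rank {T : Type u} [PartialOrder T] (hT : IsTreeOrder T) (t : T) :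
    Ordinal.{u} :=
  haveI : IsWellFounded T (fun x y => x < y) := ⟨hT.wf⟩
  IsWellFounded.rank (fun x y : T => x < y) t

/-- `T_α`, the set of the elements of rank `α`. -/
def IsTreeOrder.level {T : Type u} [PartialOrder T] (hT : IsTreeOrder T) (α : Ordinal.{u}) : Set T :=
  {t | hT.rank t = α}

/-- `Ht(T)`, the least `α` for which `T_α` is empty. -/
noncomputable def IsTreeOrder.height {T : Type u} [PartialOrder T] (hT : IsTreeOrder T) : Ordinal.{u} :=
  sInf {α | hT.level α = ∅}

/-- An `ω₁`-tree: a tree of height `ω₁` with countable levels. -/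
structure IsOmegaOneTree (T : Type u) [PartialOrder T] : Prop where
  isTree : IsTreeOrder T
  height_eq : isTree.height = Ordinal.omega.{u} 1
  countable_level : ∀ α < Ordinal.omega.{u} 1, (isTree.level α).Countable

/-- A Suslin tree: an `ω₁`-tree without uncountable chains or antichains. (In a tree two elements
have a common upper bound if and only if they are comparable.) -/
structure IsSuslin (T : Type u) [PartialOrder T] : Prop where
  isOmegaOneTree : IsOmegaOneTree T
  countable_chain : ∀ C : Set T, IsChain (· ≤ ·) C → C.Countable
  countable_antichain : ∀ A : Set T, IsAntichain (· ≤ ·) A → A.Countable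

/-- `T|_t`, the elements of `T` comparable with `t`, with the order of `T`. -/
abbrev TreeCone {T : Type u} [PartialOrder T] (t : T) : Type u :=
  {x : T // x ≤ t ∨ t ≤ x}

theorem IsTreeOrder.cone {T : Type u} [PartialOrder T] (hT : IsTreeOrder T) (t : T) :
    IsTreeOrder (TreeCone t) := by
  intro s
  have := hT (s : T)
  let e : (fun x y : Set.Iio s => x < y) ↪r (fun x y : Set.Iio (s : T) => x < y) :=
    { toFun := fun x => ⟨x.1.1, x.2⟩
      inj' := fun x y h => Subtype.ext (Subtype.ext (Subtype.mk.inj h))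
      map_rel_iff' := Iff.rfl }
  exact e.isWellOrder

/-- The tree product of `k + 1` trees: the tuples of elements of equal rank. -/
def TreeProduct {k : ℕ} (T : Fin (k + 1) → Type u) [∀ i, PartialOrder (T i)]
    (hT : ∀ i, IsTreeOrder (T i)) : Type u :=
  {t : ∀ i, T i // ∀ i, (hT 0).rank (t 0) = (hT i).rank (t i)}

/-- The tree product is ordered by: `s < t` if and only if `s i < t i` for every `i`. -/
instance TreeProduct.instPartialOrder {k : ℕ} (T : Fin (k + 1) → Type u)
    [∀ i, PartialOrder (T i)] (hT : ∀ i, IsTreeOrder (T i)) :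
    PartialOrder (TreeProduct T hT) where
  lt s t := ∀ i, s.1 i < t.1 i
  le s t := s = t ∨ ∀ i, s.1 i < t.1 i
  le_refl s := Or.inl rfl
  le_trans s t u := by
    rintro (rfl | h) (rfl | h')
    · exact Or.inl rfl
    · exact Or.inr h'
    · exact Or.inr h
    · exact Or.inr fun i => (h i).trans (h' i)
  le_antisymm s t := by
    rintro (rfl | h) (h' | h')
    · rfl
    · rfl
    · exact h'.symm
    · exact absurd ((h 0).trans (h' 0)) (lt_irrefl _)
  lt_iff_le_not_ge s t := by
    constructor
    · intro h
      refine ⟨Or.inr h, ?_⟩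
      rintro (rfl | h')
      · exact lt_irrefl _ (h 0)
      · exact lt_irrefl _ ((h 0).trans (h' 0))
    · rintro ⟨rfl | h, h'⟩
      · exact absurd (Or.inl rfl) h'
      · exact h

/-- A full Suslin tree: an `ω₁`-tree such that, for any finitely many (at least one) distinct
elements `t i` of equal rank, the tree product of the trees `T|_{t i}` is Suslin. -/
structure IsFullSuslin (T : Type u) [PartialOrder T] : Prop where
  isOmegaOneTree : IsOmegaOneTree T
  product_suslin : ∀ (k : ℕ) (t : Fin (k + 1) → T), Function.Injective t →
    (∀ i j, isOmegaOneTree.isTree.rank (t i) = isOmegaOneTree.isTree.rank (t j)) →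
    IsSuslin (TreeProduct (fun i => TreeCone (t i)) fun i => isOmegaOneTree.isTree.cone (t i))

/-! The tree consists of traces `V_a ∩ b`, `b ≤ a < ω₁`, of the sections `V_a` of one binary
relation `V` on `ω₁` (`schemeRel`), ordered by end-extension. Only the values `V a x` with `x < a`
matter. `V` is built by recursion along the scheme. Inside a set `F` of level `k + 1`, the relation
of `a` to `x` is inherited from level `k` if `x` lies in the root or in the piece of `a`. If instead
`a ∈ F_i \ R` and `x` lies outside `R` in another piece, a finite table attached to `i` decides. Its
arguments are the trace of `V_a` on the root `R` and the position of `x` in `F`. The type is chosen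
with so many pieces that every table on subsets of `r_{k+1}` and positions below `m_k` is attached
to some `i ≥ 1`.

Levels are countable because a section sees the elements outside its piece only through its trace on
the root: the trace of `V_a` below `b` is determined by its part in any single member of the scheme
that contains `a` and `b` (`schemeRel_congr`, `countable_traces`).

Capturing puts similar data `b_i ≤ a_j(b_i)` into the pieces of one `F`, and the index `i` of the
table can then be chosen at will. A constant table makes `V_{a(b_i)}` and `V_{a(b_0)}` disagree at
`b_0`, which excludes uncountable chains (`exists_lt_not_schemeRel_iff`). For antichains in
products, the coordinates differ on a finite set `D`, which capturing places inside the root, so the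
traces of the coordinates on the root are distinct. Hence a single table can make every
`V_{a_j(b_i)}` copy `V_{a_j(b_0)}` below `b_0` simultaneously, and two tuples become comparable
(`exists_lt_schemeRel_iff`). -/

/-! ### The type and the finite approximations -/

/-- The finite relation coded by the piece of index `i`. Every finite relation occurs at some
`i ≥ 1`. -/
def pieceCode (i : ℕ) : Finset (Finset ℕ × ℕ) :=
  (Encodable.decode (i - 1)).getD ∅

/-- A number of pieces that suffices to code every relation between subsets of `range r` and
elements of `range m`. -/
noncomputable def codeBound (r m : ℕ) : ℕ :=
  ((Finset.range r).powerset ×ˢ Finset.range m).powerset.sup Encodable.encode + 2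

theorem exists_pieceCode_eq {r m : ℕ} {H : Finset (Finset ℕ × ℕ)}
    (hH : H ⊆ (Finset.range r).powerset ×ˢ Finset.range m) :
    ∃ i, 0 < i ∧ i < codeBound r m ∧ pieceCode i = H := by
  -- The code is shifted by one because piece `0` is kept for the element to be copied or
  -- contradicted. The summand `2` in `codeBound` makes room for the shift and also gives at least
  -- two pieces.
  refine ⟨Encodable.encode H + 1, by omega, ?_, by simp [pieceCode]⟩
  have := Finset.le_sup (f := Encodable.encode) (Finset.mem_powerset.2 hH)
  unfold codeBound
  omega

/-- The sizes `m k` of the type used below. -/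
noncomputable def codingSize : ℕ → ℕ
  | 0 => 1
  | k + 1 => (Nat.unpair k).1 +
      (codingSize k - (Nat.unpair k).1) * codeBound (Nat.unpair k).1 (codingSize k)

/-- At least two pieces at least double the nonempty part outside the root, so the size grows at
each step. Hence the root size `(Nat.unpair k).1 ≤ k` is always admissible. -/
theorem lt_codingSize (k : ℕ) : k < codingSize k := by
  induction k with
  | zero => simp [codingSize]
  | succ k ih =>
    have h1 : (Nat.unpair k).1 ≤ k := Nat.unpair_left_le k
    have h2 : 2 ≤ codeBound (Nat.unpair k).1 (codingSize k) := by unfold codeBound; omega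
    have h3 := Nat.mul_le_mul_left (codingSize k - (Nat.unpair k).1) h2
    rw [codingSize]
    omega

/-- A type with enough pieces on each level to code all relations `pieceCode i`. -/
noncomputable def codingType : SchemeType where
  m := codingSize
  n k := codeBound (Nat.unpair (k - 1)).1 (codingSize (k - 1))
  r k := (Nat.unpair (k - 1)).1
  m_zero := rfl
  two_le_n k := by unfold codeBound; omega
  r_infinite s := by
    refine Set.infinite_of_injective_forall_mem (f := fun j => Nat.pair s j) ?_ (by simp)
    intro a b hab
    exact (Nat.pair_eq_pair.1 hab).2
  r_lt_m k := (Nat.unpair_left_le k).trans_lt (lt_codingSize k)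
  m_succ k := rfl

theorem codingType_exists_pieceCode_eq (k : ℕ) {H : Finset (Finset ℕ × ℕ)}
    (hH : H ⊆ (Finset.range (codingType.r (k + 1))).powerset ×ˢ Finset.range (codingType.m k)) :
    ∃ i, 0 < i ∧ i < codingType.n (k + 1) ∧ pieceCode i = H :=
  exists_pieceCode_eq hH

namespace SchemeType

variable (τ : SchemeType)

/-- The index of the piece that contains the element at position `a` of a set of level `k + 1`,
provided that it is not in the root. -/
def pieceIdx (k a : ℕ) : ℕ :=
  (a - τ.r (k + 1)) / (τ.m k - τ.r (k + 1))

/-- The position within its piece of the element at position `a` of a set of level `k + 1`. -/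
def piecePos (k a : ℕ) : ℕ :=
  if a < τ.r (k + 1) then a else τ.r (k + 1) + (a - τ.r (k + 1)) % (τ.m k - τ.r (k + 1))

open Classical in
/-- The relation between the positions in sets of level `k` that is the common isomorphism type
of the restrictions of the relation `schemeRel` to these sets. -/
noncomputable def posRel : ℕ → ℕ → ℕ → Prop
  | 0, _, _ => False
  | k + 1, a, x =>
    if x < τ.r (k + 1) ∨ τ.pieceIdx k a = τ.pieceIdx k x then
      posRel k (τ.piecePos k a) (τ.piecePos k x)
    else ((Finset.range (τ.r (k + 1))).filter fun y => posRel k (τ.piecePos k a) y, x) ∈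
      pieceCode (τ.pieceIdx k a)

variable {τ}

theorem pieceIdx_of_eq {k i b : ℕ} (hb : b < τ.m k) :
    τ.pieceIdx k (τ.r (k + 1) + i * (τ.m k - τ.r (k + 1)) + (b - τ.r (k + 1))) = i := by
  have := τ.r_lt_m k
  have h0 : 0 < τ.m k - τ.r (k + 1) := by omega
  rw [pieceIdx, add_assoc, Nat.add_sub_cancel_left, mul_comm, Nat.mul_add_div h0,
    Nat.div_eq_of_lt (by omega), add_zero]

theorem piecePos_of_eq {k i b : ℕ} (hb : b < τ.m k) (hr : τ.r (k + 1) ≤ b) :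
    τ.piecePos k (τ.r (k + 1) + i * (τ.m k - τ.r (k + 1)) + (b - τ.r (k + 1))) = b := by
  rw [piecePos, if_neg (by omega), add_assoc, Nat.add_sub_cancel_left, mul_comm,
    Nat.mul_add_mod, Nat.mod_eq_of_lt (by omega)]
  omega

end SchemeType

/-! ### Positions in the members of a construction scheme -/

/-- The number of elements of `F` below `a`. -/
noncomputable def finsetPos (F : Finset Ordinal.{0}) (a : Ordinal.{0}) : ℕ :=
  (F.filter (· < a)).card

theorem finsetPos_congr {E F : Finset Ordinal.{0}} {a : Ordinal.{0}}
    (h : ∀ x < a, x ∈ E ↔ x ∈ F) : finsetPos E a = finsetPos F a := by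
  unfold finsetPos
  congr 1
  ext x
  simp only [Finset.mem_filter]
  constructor
  · rintro ⟨h1, h2⟩
    exact ⟨(h x h2).1 h1, h2⟩
  · rintro ⟨h1, h2⟩
    exact ⟨(h x h2).2 h1, h2⟩

theorem finsetPos_lt_card {F : Finset Ordinal.{0}} {a : Ordinal.{0}} (ha : a ∈ F) :
    finsetPos F a < F.card := by
  refine Finset.card_lt_card ⟨Finset.filter_subset _ _, fun h => ?_⟩
  exact lt_irrefl a (Finset.mem_filter.1 (h ha)).2

theorem finsetPos_lt_finsetPos {F : Finset Ordinal.{0}} {a b : Ordinal.{0}} (ha : a ∈ F)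
    (hab : a < b) : finsetPos F a < finsetPos F b := by
  refine Finset.card_lt_card ⟨fun x hx => ?_, fun h => ?_⟩
  · simp only [Finset.mem_filter] at hx ⊢
    exact ⟨hx.1, hx.2.trans hab⟩
  · exact lt_irrefl a (Finset.mem_filter.1 (h (Finset.mem_filter.2 ⟨ha, hab⟩))).2

theorem finsetPos_inj {F : Finset Ordinal.{0}} {a b : Ordinal.{0}} (ha : a ∈ F) (hb : b ∈ F)
    (h : finsetPos F a = finsetPos F b) : a = b := by
  rcases lt_trichotomy a b with hab | hab | hab
  · exact absurd h (finsetPos_lt_finsetPos ha hab).ne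
  · exact hab
  · exact absurd h (finsetPos_lt_finsetPos hb hab).ne'

theorem exists_finsetPos_eq {F : Finset Ordinal.{0}} {p : ℕ} (hp : p < F.card) :
    ∃ a ∈ F, finsetPos F a = p := by
  have hinj : Set.InjOn (finsetPos F) F := fun a ha b hb h => finsetPos_inj ha hb h
  have hsub : F.image (finsetPos F) ⊆ Finset.range F.card := by
    intro q hq
    obtain ⟨a, ha, rfl⟩ := Finset.mem_image.1 hq
    exact Finset.mem_range.2 (finsetPos_lt_card ha)
  have heq := Finset.eq_of_subset_of_card_le hsub
    (by rw [Finset.card_range, Finset.card_image_of_injOn hinj])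
  have : p ∈ F.image (finsetPos F) := heq ▸ Finset.mem_range.2 hp
  simpa using this

/-- An order isomorphism that maps `c` onto `d` preserves positions. -/
theorem finsetPos_orderIso {E F c d : Finset Ordinal.{0}} (φ : {a // a ∈ E} ≃o {a // a ∈ F})
    (hc : c ⊆ E) (hd : d ⊆ F)
    (hφ : ∀ x : {a // a ∈ E}, (x : Ordinal.{0}) ∈ c ↔ (φ x : Ordinal.{0}) ∈ d)
    {a : Ordinal.{0}} (ha : a ∈ E) : finsetPos d (φ ⟨a, ha⟩) = finsetPos c a := by
  symm
  refine Finset.card_bij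
    (fun x hx => (φ ⟨x, hc (Finset.mem_filter.1 hx).1⟩ : Ordinal.{0})) ?_ ?_ ?_
  · intro x hx
    refine Finset.mem_filter.2 ⟨(hφ _).1 (Finset.mem_filter.1 hx).1, ?_⟩
    exact φ.strictMono (show (⟨x, _⟩ : {a // a ∈ E}) < ⟨a, ha⟩ from (Finset.mem_filter.1 hx).2)
  · intro x hx y hy hxy
    exact congrArg Subtype.val (φ.injective (Subtype.ext hxy))
  · intro y hy
    obtain ⟨hyd, hy⟩ := Finset.mem_filter.1 hy
    have hlt : φ.symm ⟨y, hd hyd⟩ < ⟨a, ha⟩ := by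
      rw [← φ.lt_iff_lt, φ.apply_symm_apply]
      exact hy
    exact ⟨φ.symm ⟨y, hd hyd⟩, Finset.mem_filter.2 ⟨(hφ _).2 (by simpa using hyd), hlt⟩, by simp⟩

/-! ### Positions and the relation in the pieces of a canonical decomposition -/

namespace IsCanonicalDecomposition

variable {τ : SchemeType} {𝓕 : Set (Finset Ordinal.{0})} {k : ℕ} {F R : Finset Ordinal.{0}}
  {f : ℕ → Finset Ordinal.{0}} {i j : ℕ} {a x : Ordinal.{0}}

theorem root_subset (h : IsCanonicalDecomposition τ 𝓕 k F f R) (hi : i < τ.n (k + 1)) :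
    R ⊆ f i := by
  have h2 := τ.two_le_n k
  obtain ⟨j, hj, hij⟩ : ∃ j, j < τ.n (k + 1) ∧ i ≠ j := by
    rcases Nat.eq_zero_or_pos i with rfl | h0
    · exact ⟨1, by omega, by omega⟩
    · exact ⟨0, by omega, by omega⟩
  rw [← h.delta_system i hi j hj hij]
  exact Finset.inter_subset_left

theorem piece_subset (h : IsCanonicalDecomposition τ 𝓕 k F f R) (hi : i < τ.n (k + 1)) :
    f i ⊆ F := by
  rw [h.union_eq]
  exact Finset.subset_biUnion_of_mem f (Finset.mem_range.2 hi)

theorem mem_piece (h : IsCanonicalDecomposition τ 𝓕 k F f R) (ha : a ∈ F) :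
    ∃ i < τ.n (k + 1), a ∈ f i := by
  rw [h.union_eq] at ha
  simpa using ha

theorem mem_root (h : IsCanonicalDecomposition τ 𝓕 k F f R) (hi : i < τ.n (k + 1))
    (hj : j < τ.n (k + 1)) (hij : i ≠ j) (hai : a ∈ f i) (haj : a ∈ f j) : a ∈ R := by
  rw [← h.delta_system i hi j hj hij]
  exact Finset.mem_inter.2 ⟨hai, haj⟩

theorem mem_root_of_lt (h : IsCanonicalDecomposition τ 𝓕 k F f R) (hx : x ∈ F) (ha : a ∈ R)
    (hxa : x < a) : x ∈ R := by
  obtain ⟨i, hi, hxi⟩ := h.mem_piece hx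
  by_contra hxR
  exact lt_asymm hxa (h.root_below i hi a ha x (Finset.mem_sdiff.2 ⟨hxi, hxR⟩))

theorem finsetPos_root (h : IsCanonicalDecomposition τ 𝓕 k F f R) (ha : a ∈ R) :
    finsetPos F a = finsetPos R a := by
  refine finsetPos_congr fun x hx => ⟨fun hxF => h.mem_root_of_lt hxF ha hx, fun hxR => ?_⟩
  have h0 : 0 < τ.n (k + 1) := by have := τ.two_le_n k; omega
  exact h.piece_subset h0 (h.root_subset h0 hxR)

theorem finsetPos_piece_root (h : IsCanonicalDecomposition τ 𝓕 k F f R) (hi : i < τ.n (k + 1))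
    (ha : a ∈ R) : finsetPos (f i) a = finsetPos R a :=
  finsetPos_congr fun _ hx => ⟨fun hxF => h.mem_root_of_lt (h.piece_subset hi hxF) ha hx,
    fun hxR => h.root_subset hi hxR⟩

theorem finsetPos_root_lt (h : IsCanonicalDecomposition τ 𝓕 k F f R) (ha : a ∈ R) :
    finsetPos R a < τ.r (k + 1) :=
  h.card_root ▸ finsetPos_lt_card ha

theorem le_finsetPos_piece (h : IsCanonicalDecomposition τ 𝓕 k F f R) (hi : i < τ.n (k + 1))
    (ha : a ∈ f i) (haR : a ∉ R) : τ.r (k + 1) ≤ finsetPos (f i) a := by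
  rw [← h.card_root]
  refine Finset.card_le_card fun x hx => Finset.mem_filter.2 ⟨h.root_subset hi hx, ?_⟩
  exact h.root_below i hi x hx a (Finset.mem_sdiff.2 ⟨ha, haR⟩)

/-- Below `a` lie the blocks `f j \ R` with `j < i`, each of size `m k - r (k + 1)`, and the part of
`f i` below `a`, which includes all of `R`. -/
theorem finsetPos_piece (hF : IsConstructionScheme τ (Set.Iio (Ordinal.omega 1)) 𝓕)
    (h : IsCanonicalDecomposition τ 𝓕 k F f R)
    (hi : i < τ.n (k + 1)) (ha : a ∈ f i) (haR : a ∉ R) :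
    finsetPos F a =
      τ.r (k + 1) + i * (τ.m k - τ.r (k + 1)) + (finsetPos (f i) a - τ.r (k + 1)) := by
  have hsplit : F.filter (· < a) =
      ((Finset.range i).biUnion fun j => f j \ R) ∪ (f i).filter (· < a) := by
    ext x
    simp only [Finset.mem_filter, Finset.mem_union, Finset.mem_biUnion, Finset.mem_range,
      Finset.mem_sdiff]
    constructor
    · rintro ⟨hx, hxa⟩
      obtain ⟨j, hj, hxj⟩ := h.mem_piece hx
      by_cases hxR : x ∈ R
      · exact Or.inr ⟨h.root_subset hi hxR, hxa⟩
      rcases lt_trichotomy j i with hji | rfl | hij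
      · exact Or.inl ⟨j, hji, hxj, hxR⟩
      · exact Or.inr ⟨hxj, hxa⟩
      · exact absurd hxa (h.pieces_below i j hij hj a (Finset.mem_sdiff.2 ⟨ha, haR⟩) x
          (Finset.mem_sdiff.2 ⟨hxj, hxR⟩)).not_gt
    · rintro (⟨j, hji, hxj, hxR⟩ | ⟨hx, hxa⟩)
      · exact ⟨h.piece_subset (hji.trans hi) hxj, h.pieces_below j i hji hi x
          (Finset.mem_sdiff.2 ⟨hxj, hxR⟩) a (Finset.mem_sdiff.2 ⟨ha, haR⟩)⟩
      · exact ⟨h.piece_subset hi hx, hxa⟩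
  have hdisj : Disjoint ((Finset.range i).biUnion fun j => f j \ R) ((f i).filter (· < a)) := by
    rw [Finset.disjoint_left]
    intro x hx hx'
    simp only [Finset.mem_filter, Finset.mem_biUnion, Finset.mem_range,
      Finset.mem_sdiff] at hx hx'
    obtain ⟨j, hji, hxj, hxR⟩ := hx
    exact hxR (h.mem_root (hji.trans hi) hi hji.ne hxj hx'.1)
  have hcard : ((Finset.range i).biUnion fun j => f j \ R).card = i * (τ.m k - τ.r (k + 1)) := by
    rw [Finset.card_biUnion]
    · rw [Finset.sum_const_nat (m := τ.m k - τ.r (k + 1)), Finset.card_range]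
      intro j hj
      have hj := (Finset.mem_range.1 hj).trans hi
      rw [Finset.card_sdiff_of_subset (h.root_subset hj), h.card_root,
        hF.card_eq k _ (h.piece_mem j hj)]
    · intro j hj j' hj' hne
      rw [Finset.mem_coe, Finset.mem_range] at hj hj'
      rw [Function.onFun, Finset.disjoint_left]
      intro x hx hx'
      rw [Finset.mem_sdiff] at hx hx'
      exact hx.2 (h.mem_root (hj.trans hi) (hj'.trans hi) hne hx.1 hx'.1)
  have hle := h.le_finsetPos_piece hi ha haR
  have hpos : finsetPos F a = i * (τ.m k - τ.r (k + 1)) + finsetPos (f i) a := by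
    rw [← hcard, finsetPos, hsplit, Finset.card_union_of_disjoint hdisj, finsetPos]
  omega

theorem pieceIdx_finsetPos (hF : IsConstructionScheme τ (Set.Iio (Ordinal.omega 1)) 𝓕)
    (h : IsCanonicalDecomposition τ 𝓕 k F f R)
    (hi : i < τ.n (k + 1)) (ha : a ∈ f i) (haR : a ∉ R) :
    τ.pieceIdx k (finsetPos F a) = i := by
  rw [finsetPos_piece hF h hi ha haR, SchemeType.pieceIdx_of_eq]
  exact hF.card_eq k _ (h.piece_mem i hi) ▸ finsetPos_lt_card ha

theorem piecePos_finsetPos (hF : IsConstructionScheme τ (Set.Iio (Ordinal.omega 1)) 𝓕)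
    (h : IsCanonicalDecomposition τ 𝓕 k F f R)
    (hi : i < τ.n (k + 1)) (ha : a ∈ f i) :
    τ.piecePos k (finsetPos F a) = finsetPos (f i) a := by
  by_cases haR : a ∈ R
  · rw [h.finsetPos_root haR, h.finsetPos_piece_root hi haR, SchemeType.piecePos,
      if_pos (h.finsetPos_root_lt haR)]
  · rw [finsetPos_piece hF h hi ha haR, SchemeType.piecePos_of_eq]
    · exact hF.card_eq k _ (h.piece_mem i hi) ▸ finsetPos_lt_card ha
    · exact h.le_finsetPos_piece hi ha haR

theorem finsetPos_lt_iff_mem_root (hF : IsConstructionScheme τ (Set.Iio (Ordinal.omega 1)) 𝓕)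
    (h : IsCanonicalDecomposition τ 𝓕 k F f R) (ha : a ∈ F) :
    finsetPos F a < τ.r (k + 1) ↔ a ∈ R := by
  refine ⟨fun hlt => ?_, fun haR => h.finsetPos_root haR ▸ h.finsetPos_root_lt haR⟩
  by_contra haR
  obtain ⟨i, hi, hai⟩ := h.mem_piece ha
  rw [finsetPos_piece hF h hi hai haR] at hlt
  omega

/-- The condition `x < a` excludes `a ∈ R`, `x ∉ R`. In that case `pieceIdx` of the position of `a`
is `0` by truncated subtraction and need not be the index of the piece of `x`. -/
theorem posRel_piece (hF : IsConstructionScheme τ (Set.Iio (Ordinal.omega 1)) 𝓕)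
    (h : IsCanonicalDecomposition τ 𝓕 k F f R)
    (hi : i < τ.n (k + 1)) (ha : a ∈ f i) (hx : x ∈ f i) (hxa : x < a) :
    τ.posRel (k + 1) (finsetPos F a) (finsetPos F x) ↔
      τ.posRel k (finsetPos (f i) a) (finsetPos (f i) x) := by
  have hc : finsetPos F x < τ.r (k + 1) ∨
      τ.pieceIdx k (finsetPos F a) = τ.pieceIdx k (finsetPos F x) := by
    by_cases hxR : x ∈ R
    · exact Or.inl ((finsetPos_lt_iff_mem_root hF h (h.piece_subset hi hx)).2 hxR)
    · have haR : a ∉ R := fun haR => hxR (h.mem_root_of_lt (h.piece_subset hi hx) haR hxa)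
      exact Or.inr (by rw [pieceIdx_finsetPos hF h hi ha haR, pieceIdx_finsetPos hF h hi hx hxR])
  rw [SchemeType.posRel, if_pos hc, piecePos_finsetPos hF h hi ha, piecePos_finsetPos hF h hi hx]

open Classical in
-- Outside its own piece the section of `a` depends only on the index `i` and on the trace of `a` on
-- the root. Both the countability of levels and the control by tables rest on this.
theorem posRel_of_ne (hF : IsConstructionScheme τ (Set.Iio (Ordinal.omega 1)) 𝓕)
    (h : IsCanonicalDecomposition τ 𝓕 k F f R)
    (hi : i < τ.n (k + 1)) (hj : j < τ.n (k + 1)) (hij : i ≠ j) (ha : a ∈ f i) (haR : a ∉ R)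
    (hx : x ∈ f j) (hxR : x ∉ R) :
    τ.posRel (k + 1) (finsetPos F a) (finsetPos F x) ↔
      ((Finset.range (τ.r (k + 1))).filter fun y => τ.posRel k (finsetPos (f i) a) y,
        finsetPos F x) ∈ pieceCode i := by
  have hc : ¬ (finsetPos F x < τ.r (k + 1) ∨
      τ.pieceIdx k (finsetPos F a) = τ.pieceIdx k (finsetPos F x)) := by
    rw [finsetPos_lt_iff_mem_root hF h (h.piece_subset hj hx),
      pieceIdx_finsetPos hF h hi ha haR, pieceIdx_finsetPos hF h hj hx hxR]
    exact fun h => h.elim hxR hij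
  rw [SchemeType.posRel, if_neg hc, piecePos_finsetPos hF h hi ha, pieceIdx_finsetPos hF h hi ha haR]

end IsCanonicalDecomposition

/-! ### The relation defined by a construction scheme -/

theorem IsWellFounded.rank_le_of_lt {α : Type u} {r : α → α → Prop} [hwf : IsWellFounded α r]
    {h : α → Ordinal.{u}} (hh : ∀ a b, r a b → h a < h b) (a : α) :
    IsWellFounded.rank r a ≤ h a := by
  induction hwf.wf.apply a with
  | intro a _ ih =>
    rw [IsWellFounded.rank_eq]
    exact Ordinal.iSup_le fun b => Order.succ_le_of_lt ((ih b b.2).trans_lt (hh _ _ b.2))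

theorem not_countable_Iio_omega_one : ¬ (Set.Iio (Ordinal.omega.{0} 1)).Countable := by
  rw [← Cardinal.le_aleph0_iff_set_countable, Cardinal.mk_Iio_ordinal, Ordinal.card_omega]
  simp

theorem Set.exists_not_countable_fiber {α β : Type*} [Countable β] {s : Set α}
    (hs : ¬ s.Countable) (p : α → β) : ∃ b, ¬ {x ∈ s | p x = b}.Countable := by
  by_contra! h
  refine hs ((Set.countable_iUnion h).mono fun x hx => ?_)
  exact Set.mem_iUnion.2 ⟨p x, hx, rfl⟩

/-- The relation on `ω₁` whose restrictions to the sets of level `k` have the type `posRel k`. -/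
def schemeRel (τ : SchemeType) (𝓕 : Set (Finset Ordinal.{0})) (a x : Ordinal.{0}) : Prop :=
  ∃ k, ∃ F ∈ schemeLevel 𝓕 k, a ∈ F ∧ x ∈ F ∧ τ.posRel k (finsetPos F a) (finsetPos F x)

/-- Cardinality is strictly monotone for `⊊`, so it bounds the rank, which is therefore finite. -/
theorem exists_mem_schemeLevel {𝓕 : Set (Finset Ordinal.{0})} {F : Finset Ordinal.{0}}
    (hF : F ∈ 𝓕) : ∃ k, F ∈ schemeLevel 𝓕 k := by
  have h := IsWellFounded.rank_le_of_lt (r := fun A B : 𝓕 => A < B)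
    (h := fun A => ((Finset.card A.1 : ℕ) : Ordinal)) (fun A B hAB => by
      simpa using Finset.card_lt_card hAB) ⟨F, hF⟩
  obtain ⟨k, hk⟩ := Ordinal.lt_omega0.1 (h.trans_lt (Ordinal.natCast_lt_omega0 _))
  exact ⟨k, hF, hk⟩

namespace IsConstructionScheme

variable {τ : SchemeType} {𝓕 : Set (Finset Ordinal.{0})}

theorem exists_level_superset (hF : IsConstructionScheme τ (Set.Iio (Ordinal.omega 1)) 𝓕)
    {A : Finset Ordinal.{0}} (hA : ∀ a ∈ A, a < Ordinal.omega 1) :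
    ∃ k, ∃ F ∈ schemeLevel 𝓕 k, A ⊆ F := by
  obtain ⟨F, hF, hAF⟩ := hF.cofinal A hA
  obtain ⟨k, hk⟩ := exists_mem_schemeLevel hF
  exact ⟨k, F, hk, hAF⟩

theorem mem_iff_of_le (hF : IsConstructionScheme τ (Set.Iio (Ordinal.omega 1)) 𝓕) {k : ℕ}
    {E G : Finset Ordinal.{0}} (hE : E ∈ schemeLevel 𝓕 k) (hG : G ∈ schemeLevel 𝓕 k)
    {a x : Ordinal.{0}} (haE : a ∈ E) (haG : a ∈ G) (hxa : x ≤ a) : x ∈ E ↔ x ∈ G := by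
  obtain ⟨h1, h2⟩ := hF.initSeg k G hG E hE
  have ha : a ∈ E ∩ G := Finset.mem_inter.2 ⟨haE, haG⟩
  exact ⟨fun hx => (Finset.mem_inter.1 (h1.2 a ha x hx hxa)).2,
    fun hx => (Finset.mem_inter.1 (h2.2 a ha x hx hxa)).1⟩

theorem finsetPos_eq (hF : IsConstructionScheme τ (Set.Iio (Ordinal.omega 1)) 𝓕) {k : ℕ}
    {E G : Finset Ordinal.{0}} (hE : E ∈ schemeLevel 𝓕 k) (hG : G ∈ schemeLevel 𝓕 k)
    {a x : Ordinal.{0}} (haE : a ∈ E) (haG : a ∈ G) (hxa : x ≤ a) :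
    finsetPos E x = finsetPos G x :=
  finsetPos_congr fun _ hy => hF.mem_iff_of_le hE hG haE haG (hy.le.trans hxa)

/-- Descend from `G` one level at a time to a piece that contains `a`; each step preserves the
relation by `posRel_piece`. -/
theorem exists_subset_level (hF : IsConstructionScheme τ (Set.Iio (Ordinal.omega 1)) 𝓕)
    {l k : ℕ} (hlk : l ≤ k) {G : Finset Ordinal.{0}} (hG : G ∈ schemeLevel 𝓕 k)
    {a : Ordinal.{0}} (ha : a ∈ G) :
    ∃ E ∈ schemeLevel 𝓕 l, a ∈ E ∧ E ⊆ G ∧ ∀ y ∈ E, ∀ x ∈ E, x < y →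
      (τ.posRel k (finsetPos G y) (finsetPos G x) ↔
        τ.posRel l (finsetPos E y) (finsetPos E x)) := by
  induction k, hlk using Nat.le_induction generalizing G with
  | base => exact ⟨G, hG, ha, subset_rfl, fun _ _ _ _ _ => Iff.rfl⟩
  | succ k hlk ih =>
    obtain ⟨f, R, h⟩ := hF.decomposition k G hG
    obtain ⟨i, hi, hai⟩ := h.mem_piece ha
    obtain ⟨E, hE, haE, hEf, hrel⟩ := ih (h.piece_mem i hi) hai
    refine ⟨E, hE, haE, hEf.trans (h.piece_subset hi), fun y hy x hx hxy => ?_⟩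
    rw [h.posRel_piece hF hi (hEf hy) (hEf hx) hxy, hrel y hy x hx hxy]

theorem mem_of_le (hF : IsConstructionScheme τ (Set.Iio (Ordinal.omega 1)) 𝓕)
    {l k : ℕ} (hlk : l ≤ k) {E G : Finset Ordinal.{0}} (hE : E ∈ schemeLevel 𝓕 l)
    (hG : G ∈ schemeLevel 𝓕 k) {a x : Ordinal.{0}} (haE : a ∈ E) (haG : a ∈ G) (hx : x ∈ E)
    (hxa : x ≤ a) : x ∈ G := by
  obtain ⟨E', hE', haE', hE'G, -⟩ := hF.exists_subset_level hlk hG haG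
  exact hE'G ((hF.mem_iff_of_le hE hE' haE haE' hxa).1 hx)

theorem posRel_iff_of_le (hF : IsConstructionScheme τ (Set.Iio (Ordinal.omega 1)) 𝓕)
    {l k : ℕ} (hlk : l ≤ k) {E G : Finset Ordinal.{0}} (hE : E ∈ schemeLevel 𝓕 l)
    (hG : G ∈ schemeLevel 𝓕 k) {a x : Ordinal.{0}} (haE : a ∈ E) (haG : a ∈ G) (hx : x ∈ E)
    (hxa : x < a) : τ.posRel k (finsetPos G a) (finsetPos G x) ↔
      τ.posRel l (finsetPos E a) (finsetPos E x) := by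
  obtain ⟨E', hE', haE', hE'G, hrel⟩ := hF.exists_subset_level hlk hG haG
  rw [hrel a haE' x ((hF.mem_iff_of_le hE hE' haE haE' hxa.le).1 hx) hxa,
    hF.finsetPos_eq hE hE' haE haE' le_rfl, hF.finsetPos_eq hE hE' haE haE' hxa.le]

/-- Sets of one level that share `a` agree up to `a`, and the relation survives the descent to lower
levels. So the set that witnesses `schemeRel` is irrelevant. -/
theorem schemeRel_iff (hF : IsConstructionScheme τ (Set.Iio (Ordinal.omega 1)) 𝓕)
    {k : ℕ} {G : Finset Ordinal.{0}} (hG : G ∈ schemeLevel 𝓕 k) {a x : Ordinal.{0}}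
    (ha : a ∈ G) (hx : x ∈ G) (hxa : x < a) :
    schemeRel τ 𝓕 a x ↔ τ.posRel k (finsetPos G a) (finsetPos G x) := by
  refine ⟨?_, fun h => ⟨k, G, hG, ha, hx, h⟩⟩
  rintro ⟨l, E, hE, haE, hxE, hrel⟩
  rcases le_total l k with hlk | hkl
  · exact (hF.posRel_iff_of_le hlk hE hG haE ha hxE hxa).2 hrel
  · exact (hF.posRel_iff_of_le hkl hG hE ha haE hx hxa).1 hrel

/-- The relation between an element of a piece and an element of the root. -/
theorem schemeRel_root_iff (hF : IsConstructionScheme τ (Set.Iio (Ordinal.omega 1)) 𝓕)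
    {k i : ℕ} {G R : Finset Ordinal.{0}} {f : ℕ → Finset Ordinal.{0}}
    (h : IsCanonicalDecomposition τ 𝓕 k G f R) (hi : i < τ.n (k + 1)) {a x : Ordinal.{0}}
    (ha : a ∈ f i) (haR : a ∉ R) (hx : x ∈ R) :
    schemeRel τ 𝓕 a x ↔ τ.posRel k (finsetPos (f i) a) (finsetPos R x) := by
  rw [hF.schemeRel_iff (h.piece_mem i hi) ha (h.root_subset hi hx)
    (h.root_below i hi x hx a (Finset.mem_sdiff.2 ⟨ha, haR⟩)), h.finsetPos_piece_root hi hx]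

/-- Induction on the level. Inside the piece of `a` the induction hypothesis applies; outside it the
value is read from a table, whose index and arguments are the same for `a` and `a'`. Two sets `G`,
`G'` are needed because `a` and `a'` may lie in different pieces when `b` is in the root. -/
theorem schemeRel_congr_level (hF : IsConstructionScheme τ (Set.Iio (Ordinal.omega 1)) 𝓕)
    {l : ℕ} {E E' : Finset Ordinal.{0}} (hE : E ∈ schemeLevel 𝓕 l)
    (hE' : E' ∈ schemeLevel 𝓕 l) {a a' b : Ordinal.{0}} (hba : b ≤ a) (hba' : b ≤ a')
    (haE : a ∈ E) (hbE : b ∈ E) (haE' : a' ∈ E') (hbE' : b ∈ E')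
    (hrel : ∀ x ∈ E, x < b → (schemeRel τ 𝓕 a x ↔ schemeRel τ 𝓕 a' x)) {k : ℕ} (hlk : l ≤ k) :
    ∀ G ∈ schemeLevel 𝓕 k, ∀ G' ∈ schemeLevel 𝓕 k, a ∈ G → b ∈ G → a' ∈ G' → b ∈ G' →
      ∀ x ∈ G, x < b → (schemeRel τ 𝓕 a x ↔ schemeRel τ 𝓕 a' x) := by
  classical
  induction k, hlk using Nat.le_induction with
  | base =>
    intro G hG G' hG' haG hbG haG' hbG' x hx hxb
    exact hrel x ((hF.mem_iff_of_le hG hE hbG hbE hxb.le).1 hx) hxb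
  | succ k hlk ih =>
    intro G hG G' hG' haG hbG haG' hbG' x hx hxb
    obtain ⟨f, R, h⟩ := hF.decomposition k G hG
    obtain ⟨f', R', h'⟩ := hF.decomposition k G' hG'
    obtain ⟨i, hi, hai⟩ := h.mem_piece haG
    obtain ⟨i', hi', hai'⟩ := h'.mem_piece haG'
    have hbi : b ∈ f i := hF.mem_of_le hlk hE (h.piece_mem i hi) haE hai hbE hba
    have hbi' : b ∈ f' i' := hF.mem_of_le hlk hE' (h'.piece_mem i' hi') haE' hai' hbE' hba'
    have ih := ih (f i) (h.piece_mem i hi) (f' i') (h'.piece_mem i' hi') hai hbi hai' hbi'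
    have hpos : ∀ y ≤ b, finsetPos G y = finsetPos G' y := fun y hy =>
      hF.finsetPos_eq hG hG' hbG hbG' hy
    by_cases hxi : x ∈ f i
    · exact ih x hxi hxb
    have hxG' : x ∈ G' := (hF.mem_iff_of_le hG hG' hbG hbG' hxb.le).1 hx
    have hxR : x ∉ R := fun hxR => hxi (h.root_subset hi hxR)
    have hbR : b ∉ R := fun hbR => hxR (h.mem_root_of_lt hx hbR hxb)
    have hbR' : b ∉ R' := by
      rwa [← h'.finsetPos_lt_iff_mem_root hF hbG', ← hpos b le_rfl,
        h.finsetPos_lt_iff_mem_root hF hbG]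
    have haR : a ∉ R := fun haR => hbR (hba.eq_or_lt.elim (fun hba => hba ▸ haR)
      (h.mem_root_of_lt hbG haR))
    have haR' : a' ∉ R' := fun haR' => hbR' (hba'.eq_or_lt.elim (fun hba' => hba' ▸ haR')
      (h'.mem_root_of_lt hbG' haR'))
    -- `G` and `G'` share `b` and hence agree up to `b`. So `b` has the same position in both, and
    -- the same piece index.
    have hii' : i = i' := by
      rw [← h.pieceIdx_finsetPos hF hi hbi hbR, ← h'.pieceIdx_finsetPos hF hi' hbi' hbR',
        hpos b le_rfl]
    subst hii'
    have hxR' : x ∉ R' := by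
      rwa [← h'.finsetPos_lt_iff_mem_root hF hxG', ← hpos x hxb.le,
        h.finsetPos_lt_iff_mem_root hF hx]
    have hxi' : x ∉ f' i := fun hx' =>
      hxi ((hF.mem_iff_of_le (h.piece_mem i hi) (h'.piece_mem i hi) hbi hbi' hxb.le).2 hx')
    obtain ⟨j, hj, hxj⟩ := h.mem_piece hx
    obtain ⟨j', hj', hxj'⟩ := h'.mem_piece hxG'
    have hij : i ≠ j := fun hij => hxi (hij ▸ hxj)
    have hij' : i ≠ j' := fun hij => hxi' (hij ▸ hxj')
    -- The root lies below `b`, so the induction hypothesis identifies the two traces on it.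
    have htrace : ((Finset.range (τ.r (k + 1))).filter fun y =>
          τ.posRel k (finsetPos (f i) a) y) =
        (Finset.range (τ.r (k + 1))).filter fun y => τ.posRel k (finsetPos (f' i) a') y := by
      refine Finset.filter_congr fun p hp => ?_
      obtain ⟨y, hyR, rfl⟩ := exists_finsetPos_eq (F := R)
        (h.card_root.symm ▸ Finset.mem_range.1 hp)
      have hyi : y ∈ f i := h.root_subset hi hyR
      have hyb : y < b := h.root_below i hi y hyR b (Finset.mem_sdiff.2 ⟨hbi, hbR⟩)
      have hyG' : y ∈ G' := (hF.mem_iff_of_le hG hG' hbG hbG' hyb.le).1 (h.piece_subset hi hyi)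
      have hyR' : y ∈ R' := by
        rwa [← h'.finsetPos_lt_iff_mem_root hF hyG', ← hpos y hyb.le,
          h.finsetPos_lt_iff_mem_root hF (h.piece_subset hi hyi)]
      rw [← hF.schemeRel_root_iff h hi hai haR hyR, ih y hyi hyb,
        hF.schemeRel_root_iff h' hi hai' haR' hyR', ← h.finsetPos_root hyR,
        ← h'.finsetPos_root hyR', hpos y hyb.le]
    rw [hF.schemeRel_iff hG haG hx (hxb.trans_le hba),
      hF.schemeRel_iff hG' haG' hxG' (hxb.trans_le hba'),
      h.posRel_of_ne hF hi hj hij hai haR hxj hxR,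
      h'.posRel_of_ne hF hi hj' hij' hai' haR' hxj' hxR', htrace, hpos x hxb.le]

/-- If the restrictions of the relations given by `a` and `a'` agree on the part below `b` of sets
of a level that contain `a`, `b` and `a'`, `b`, respectively, then they agree below `b`. -/
theorem schemeRel_congr (hF : IsConstructionScheme τ (Set.Iio (Ordinal.omega 1)) 𝓕)
    {l : ℕ} {E E' : Finset Ordinal.{0}} (hE : E ∈ schemeLevel 𝓕 l)
    (hE' : E' ∈ schemeLevel 𝓕 l) {a a' b : Ordinal.{0}} (hba : b ≤ a) (hba' : b ≤ a')
    (haE : a ∈ E) (hbE : b ∈ E) (haE' : a' ∈ E') (hbE' : b ∈ E')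
    (hrel : ∀ x ∈ E, x < b → (schemeRel τ 𝓕 a x ↔ schemeRel τ 𝓕 a' x))
    {x : Ordinal.{0}} (hxb : x < b) : schemeRel τ 𝓕 a x ↔ schemeRel τ 𝓕 a' x := by
  have ha : a < Ordinal.omega 1 := hF.subset E hE.1 haE
  have ha' : a' < Ordinal.omega 1 := hF.subset E' hE'.1 haE'
  obtain ⟨k, G, hG, hAG⟩ := hF.exists_level_superset (A := {x, b, a, a'}) (by
    simp only [Finset.mem_insert, Finset.mem_singleton]
    rintro y (rfl | rfl | rfl | rfl)
    exacts [hxb.trans_le hba |>.trans ha, hba.trans_lt ha, ha, ha'])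
  have hxG : x ∈ G := hAG (by simp)
  have hbG : b ∈ G := hAG (by simp)
  rcases le_total l k with hlk | hkl
  · exact hF.schemeRel_congr_level hE hE' hba hba' haE hbE haE' hbE' hrel hlk G hG G hG
      (hAG (by simp)) hbG (hAG (by simp)) hbG x hxG hxb
  · exact hrel x (hF.mem_of_le hkl hG hE hbG hbE hxG hxb.le) hxb

/-- Only countably many sets `{x < b | schemeRel a x}` with `b ≤ a` exist. -/
theorem countable_traces (hF : IsConstructionScheme τ (Set.Iio (Ordinal.omega 1)) 𝓕)
    (b : Ordinal.{0}) :
    {s : Set Ordinal.{0} | ∃ a, b ≤ a ∧ a < Ordinal.omega 1 ∧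
      s = {x | x < b ∧ schemeRel τ 𝓕 a x}}.Countable := by
  classical
  have hlev : ∀ a : Ordinal.{0}, b ≤ a → a < Ordinal.omega 1 →
      ∃ l, ∃ E ∈ schemeLevel 𝓕 l, a ∈ E ∧ b ∈ E := by
    intro a hba ha
    obtain ⟨l, E, hE, hAE⟩ := hF.exists_level_superset (A := {a, b}) (by
      simp only [Finset.mem_insert, Finset.mem_singleton]
      rintro y (rfl | rfl)
      exacts [ha, hba.trans_lt ha])
    exact ⟨l, E, hE, hAE (by simp), hAE (by simp)⟩
  -- A level `l` together with the finite set of positions, in a set of that level containing `a`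
  -- and `b`, at which the trace holds. By `schemeRel_congr` such a pair determines the trace, and
  -- there are countably many pairs.
  let P : ℕ × Finset ℕ → Set Ordinal.{0} → Prop := fun p s =>
    ∃ a, b ≤ a ∧ s = {x | x < b ∧ schemeRel τ 𝓕 a x} ∧ ∃ E ∈ schemeLevel 𝓕 p.1, a ∈ E ∧ b ∈ E ∧
      p.2 = (E.filter fun x => x < b ∧ schemeRel τ 𝓕 a x).image (finsetPos E)
  have hsub : ∀ p, {s | P p s}.Subsingleton := by
    rintro ⟨l, q⟩ s ⟨a, hba, rfl, E, hE, haE, hbE, hq⟩ s' ⟨a', hba', rfl, E', hE', haE', hbE', hq'⟩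
    have key : ∀ x ∈ E, x < b → (schemeRel τ 𝓕 a x ↔ schemeRel τ 𝓕 a' x) := by
      intro x hx hxb
      have hx' : x ∈ E' := (hF.mem_iff_of_le hE hE' hbE hbE' hxb.le).1 hx
      have h1 : schemeRel τ 𝓕 a x ↔ finsetPos E x ∈ q := by
        simp only at hq
        rw [hq, Finset.mem_image]
        constructor
        · exact fun h => ⟨x, Finset.mem_filter.2 ⟨hx, hxb, h⟩, rfl⟩
        · rintro ⟨y, hy, hyx⟩
          rw [Finset.mem_filter] at hy
          exact finsetPos_inj hy.1 hx hyx ▸ hy.2.2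
      have h2 : schemeRel τ 𝓕 a' x ↔ finsetPos E' x ∈ q := by
        simp only at hq'
        rw [hq', Finset.mem_image]
        constructor
        · exact fun h => ⟨x, Finset.mem_filter.2 ⟨hx', hxb, h⟩, rfl⟩
        · rintro ⟨y, hy, hyx⟩
          rw [Finset.mem_filter] at hy
          exact finsetPos_inj hy.1 hx' hyx ▸ hy.2.2
      rw [h1, h2, hF.finsetPos_eq hE hE' hbE hbE' hxb.le]
    ext x
    exact and_congr_right fun hxb =>
      hF.schemeRel_congr hE hE' hba hba' haE hbE haE' hbE' key hxb
  refine (Set.countable_iUnion fun p => (hsub p).countable).mono ?_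
  rintro s ⟨a, hba, ha, rfl⟩
  obtain ⟨l, E, hE, haE, hbE⟩ := hlev a hba ha
  exact Set.mem_iUnion.2 ⟨(l, _), a, hba, rfl, E, hE, haE, hbE, rfl⟩

/-! ### Capturing -/

/-- Full capturing for uncountable families of finite sequences. -/
theorem _root_.FullyCapturing.exists_captured (hcap : FullyCapturing τ 𝓕) {B : Set Ordinal.{0}} (hB : ¬ B.Countable) {q : ℕ}
    (a : Fin q → Ordinal.{0} → Ordinal.{0}) (hba : ∀ b ∈ B, ∀ j, b ≤ a j b)
    (hB1 : ∀ b ∈ B, b < Ordinal.omega 1) (ha1 : ∀ b ∈ B, ∀ j, a j b < Ordinal.omega 1)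
    (D : Finset Ordinal.{0}) (hD : ∀ x ∈ D, x < Ordinal.omega 1) :
    ∃ l F f R, IsCanonicalDecomposition τ 𝓕 l F f R ∧ D ⊆ R ∧ ∃ b : ℕ → Ordinal.{0},
      ∀ i < τ.n (l + 1), b i ∈ B ∧ b i ∈ f i ∧ b i ∉ R ∧
        finsetPos (f i) (b i) = finsetPos (f 0) (b 0) ∧
        ∀ j, a j (b i) ∈ f i ∧ a j (b i) ∉ R ∧
          finsetPos (f i) (a j (b i)) = finsetPos (f 0) (a j (b 0)) := by
  classical
  let c : Ordinal.{0} → Finset Ordinal.{0} := fun b => insert b (Finset.univ.image (a · b) ∪ D)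
  have hbc : ∀ b, b ∈ c b := fun b => Finset.mem_insert_self _ _
  have hac : ∀ b j, a j b ∈ c b := fun b j => Finset.mem_insert_of_mem
    (Finset.mem_union_left _ (Finset.mem_image_of_mem (a · b) (Finset.mem_univ j)))
  have hDc : ∀ b, D ⊆ c b := fun b x hx => Finset.mem_insert_of_mem (Finset.mem_union_right _ hx)
  -- After thinning out, `b` and all `a j b` occupy fixed positions in `c b`. The isomorphisms
  -- between captured sets then respect these labels.
  obtain ⟨p, hp⟩ := Set.exists_not_countable_fiber hB
    fun b => (finsetPos (c b) b, fun j => finsetPos (c b) (a j b))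
  set B' := {b ∈ B | (finsetPos (c b) b, fun j => finsetPos (c b) (a j b)) = p} with hB'
  have hS : ¬ (c '' B').Countable := by
    intro hS
    refine hp ((hS.biUnion (t := fun (s : Finset Ordinal.{0}) _ => (s : Set Ordinal.{0}))
      fun s _ => s.countable_toSet).mono fun b hb => ?_)
    exact Set.mem_biUnion (Set.mem_image_of_mem c hb) (hbc b)
  obtain ⟨l, -, F, -, d, hdS, f, R, h, -, hd, hiso⟩ := hcap (c '' B') (by
    rintro s ⟨b, hb, rfl⟩ x hx
    simp only [c, Finset.coe_insert, Finset.coe_union, Finset.coe_image, Finset.coe_univ,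
      Set.image_univ, Set.mem_insert_iff, Set.mem_union, Set.mem_range, Finset.mem_coe] at hx
    rcases hx with rfl | ⟨j, rfl⟩ | hx
    exacts [hB1 _ hb.1, ha1 _ hb.1 j, hD x hx]) hS 0
  choose! b hbB' hcb using hdS
  have h0 : 0 < τ.n (l + 1) := by have := τ.two_le_n l; omega
  have h1 : 1 < τ.n (l + 1) := by have := τ.two_le_n l; omega
  have hmove : ∀ i < τ.n (l + 1), ∀ x ∈ c (b 0), ∀ y ∈ c (b i),
      finsetPos (c (b 0)) x = finsetPos (c (b i)) y →
      finsetPos (f i) y = finsetPos (f 0) x := by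
    intro i hi x hx y hy hxy
    obtain ⟨φ, hφ⟩ := hiso i hi
    have hx0 : x ∈ f 0 := (hd 0 h0).1 (hcb 0 h0 ▸ hx)
    rw [hcb 0 h0] at hx
    rw [hcb i hi] at hy
    rw [hcb 0 h0, hcb i hi] at hxy
    have hy' : (φ ⟨x, hx0⟩ : Ordinal.{0}) = y := by
      refine finsetPos_inj ((hφ _).1 hx) hy ?_
      rw [finsetPos_orderIso φ (hd 0 h0).1 (hd i hi).1 hφ, hxy]
    rw [← hy', finsetPos_orderIso φ subset_rfl subset_rfl (by simp)]
  have hpos : ∀ i < τ.n (l + 1), finsetPos (f i) (b i) = finsetPos (f 0) (b 0) := by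
    intro i hi
    refine hmove i hi _ (hbc _) _ (hbc _) ?_
    exact congrArg Prod.fst ((hbB' 0 h0).2.trans (hbB' i hi).2.symm)
  have hmem : ∀ i < τ.n (l + 1), b i ∈ f i := fun i hi => (hd i hi).1 (hcb i hi ▸ hbc _)
  have hroot : ∀ i < τ.n (l + 1), ∀ i' < τ.n (l + 1), b i ∈ R → b i' ∈ R := by
    intro i hi i' hi' hR
    by_contra hR'
    have h2 := h.le_finsetPos_piece hi' (hmem i' hi') hR'
    rw [hpos i' hi', ← hpos i hi, h.finsetPos_piece_root hi hR] at h2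
    exact absurd (h.finsetPos_root_lt hR) h2.not_gt
  -- Otherwise `b 0` and `b 1` would lie in the root at the same position and coincide. Then `c (b
  -- 0)` would lie in two pieces, hence in `R`, against the definition of capturing.
  have hnot : ∀ i < τ.n (l + 1), b i ∉ R := by
    intro i hi hR
    have hR0 := hroot i hi 0 h0 hR
    have hR1 := hroot i hi 1 h1 hR
    have h01 : b 1 = b 0 := by
      refine finsetPos_inj hR1 hR0 ?_
      rw [← h.finsetPos_piece_root h1 hR1, hpos 1 h1, h.finsetPos_piece_root h0 hR0]
    obtain ⟨x, hx⟩ := (hd 0 h0).2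
    rw [Finset.mem_sdiff] at hx
    refine hx.2 (h.mem_root h0 h1 zero_ne_one ((hd 0 h0).1 hx.1) ((hd 1 h1).1 ?_))
    rw [← hcb 1 h1, h01, hcb 0 h0]
    exact hx.1
  refine ⟨l, F, f, R, h, fun x hx => ?_, b, fun i hi => ⟨(hbB' i hi).1, hmem i hi, hnot i hi,
    hpos i hi, fun j => ?_⟩⟩
  · exact h.mem_root h0 h1 zero_ne_one ((hd 0 h0).1 (hcb 0 h0 ▸ hDc _ hx))
      ((hd 1 h1).1 (hcb 1 h1 ▸ hDc _ hx))
  · have haf : a j (b i) ∈ f i := (hd i hi).1 (hcb i hi ▸ hac _ j)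
    -- The root is an initial segment of `F`, so with `a j (b i)` it would contain `b i ≤ a j (b
    -- i)`.
    refine ⟨haf, fun hR => hnot i hi ?_, ?_⟩
    · exact (hba _ (hbB' i hi).1 j).eq_or_lt.elim (fun he => he ▸ hR)
        (h.mem_root_of_lt (h.piece_subset hi (hmem i hi)) hR)
    · refine hmove i hi _ (hac _ j) _ (hac _ j) ?_
      exact congrFun (congrArg Prod.snd ((hbB' 0 h0).2.trans (hbB' i hi).2.symm)) j

end IsConstructionScheme

/-! ### Splitting and copying by a choice of the table -/

namespace IsConstructionScheme

variable {𝓕 : Set (Finset Ordinal.{0})}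

theorem exists_lt_not_schemeRel_iff
    (hF : IsConstructionScheme codingType (Set.Iio (Ordinal.omega 1)) 𝓕)
    (hcap : FullyCapturing codingType 𝓕) (a : Ordinal.{0} → Ordinal.{0})
    (hba : ∀ b < Ordinal.omega 1, b < a b) (ha : ∀ b < Ordinal.omega 1, a b < Ordinal.omega 1) :
    ∃ b b', b < Ordinal.omega 1 ∧ b' < Ordinal.omega 1 ∧ b < b' ∧
      ¬ (schemeRel codingType 𝓕 (a b) b ↔ schemeRel codingType 𝓕 (a b') b) := by
  classical
  obtain ⟨l, F, f, R, h, -, b, hb⟩ := hcap.exists_captured not_countable_Iio_omega_one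
    (q := 1) (fun _ => a) (fun b hb _ => (hba b hb).le) (fun b hb => hb) (fun b hb _ => ha b hb) ∅
    (by simp)
  have h0 : 0 < codingType.n (l + 1) := by have := codingType.two_le_n l; omega
  obtain ⟨hb0, hbf0, hbR0, -, -⟩ := hb 0 h0
  -- The empty table makes `a (b i)` unrelated to `b 0`, and the full table makes it related. The
  -- one that contradicts the value for `a (b 0)` is taken.
  obtain ⟨i, hi0, hi, hcode⟩ := codingType_exists_pieceCode_eq l
    (H := if schemeRel codingType 𝓕 (a (b 0)) (b 0) then ∅ else
      (Finset.range (codingType.r (l + 1))).powerset ×ˢ Finset.range (codingType.m l)) (by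
        split_ifs <;> simp)
  obtain ⟨hbi, hbfi, hbRi, -, hj⟩ := hb i hi
  obtain ⟨haf, haR, -⟩ := hj 0
  have hlt : b 0 < b i := h.pieces_below 0 i hi0 hi _ (Finset.mem_sdiff.2 ⟨hbf0, hbR0⟩) _
    (Finset.mem_sdiff.2 ⟨hbfi, hbRi⟩)
  refine ⟨b 0, b i, hb0, hbi, hlt, ?_⟩
  have hpos : finsetPos F (b 0) < codingType.m l := by
    rw [h.finsetPos_piece hF h0 hbf0 hbR0]
    have h2 := h.le_finsetPos_piece h0 hbf0 hbR0
    have h3 : finsetPos (f 0) (b 0) < codingType.m l :=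
      hF.card_eq l _ (h.piece_mem 0 h0) ▸ finsetPos_lt_card hbf0
    omega
  rw [hF.schemeRel_iff h.mem_level (h.piece_subset hi haf) (h.piece_subset h0 hbf0)
    (hlt.trans (hba _ hbi)), h.posRel_of_ne hF hi h0 hi0.ne' haf haR hbf0 hbR0, hcode]
  split_ifs with hif
  · simp [hif]
  · simp [hif, hpos, Finset.filter_subset]

/-- Since `D` ends up in the root, the coordinates are recognised by their traces on the root. One
table can therefore prescribe a different section for each coordinate. -/
theorem exists_lt_schemeRel_iff
    (hF : IsConstructionScheme codingType (Set.Iio (Ordinal.omega 1)) 𝓕)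
    (hcap : FullyCapturing codingType 𝓕) {B : Set Ordinal.{0}} (hB : ¬ B.Countable) {q : ℕ}
    (a : Fin q → Ordinal.{0} → Ordinal.{0}) (hba : ∀ b ∈ B, ∀ j, b ≤ a j b)
    (hB1 : ∀ b ∈ B, b < Ordinal.omega 1) (ha1 : ∀ b ∈ B, ∀ j, a j b < Ordinal.omega 1)
    (D : Finset Ordinal.{0}) (hD : ∀ x ∈ D, ∀ b ∈ B, x < b)
    (hsep : ∀ b ∈ B, ∀ j j', j ≠ j' →
      ∃ x ∈ D, ¬ (schemeRel codingType 𝓕 (a j b) x ↔ schemeRel codingType 𝓕 (a j' b) x)) :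
    ∃ b ∈ B, ∃ b' ∈ B, b < b' ∧ ∀ j, ∀ x < b,
      (schemeRel codingType 𝓕 (a j b) x ↔ schemeRel codingType 𝓕 (a j b') x) := by
  classical
  obtain ⟨c, hc⟩ : B.Nonempty := Set.nonempty_iff_ne_empty.2 fun he => hB (he ▸ Set.countable_empty)
  obtain ⟨l, F, f, R, h, hDR, b, hb⟩ := hcap.exists_captured hB a hba hB1 ha1 D
    fun x hx => (hD x hx c hc).trans (hB1 c hc)
  have h0 : 0 < codingType.n (l + 1) := by have := codingType.two_le_n l; omega
  obtain ⟨hb0, hbf0, hbR0, -, hj0⟩ := hb 0 h0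
  set r := codingType.r (l + 1)
  let tr : ℕ → Finset ℕ := fun p => (Finset.range r).filter fun y => codingType.posRel l p y
  let p : Fin q → ℕ := fun j => finsetPos (f 0) (a j (b 0))
  -- The table that answers, for a trace equal to that of coordinate `j`, as the section of `a j (b
  -- 0)` does in `f 0`. It is unambiguous by `hinj` below.
  obtain ⟨i, hi0, hi, hcode⟩ := codingType_exists_pieceCode_eq l
    (H := ((Finset.range r).powerset ×ˢ Finset.range (codingType.m l)).filter
      fun z => ∃ j, z.1 = tr (p j) ∧ codingType.posRel l (p j) z.2) (Finset.filter_subset _ _)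
  obtain ⟨hbi, hbfi, hbRi, hbpos, hji⟩ := hb i hi
  have hlt : b 0 < b i := h.pieces_below 0 i hi0 hi _ (Finset.mem_sdiff.2 ⟨hbf0, hbR0⟩) _
    (Finset.mem_sdiff.2 ⟨hbfi, hbRi⟩)
  have hinj : ∀ j j', tr (p j) = tr (p j') → j = j' := by
    intro j j' hjj'
    by_contra hne
    obtain ⟨x, hx, hxn⟩ := hsep (b 0) hb0 j j' hne
    have hxR := hDR hx
    have hmem : ∀ j, finsetPos R x ∈ tr (p j) ↔ schemeRel codingType 𝓕 (a j (b 0)) x := by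
      intro j
      rw [hF.schemeRel_root_iff h h0 (hj0 j).1 (hj0 j).2.1 hxR]
      simp [tr, p, r, h.finsetPos_root_lt hxR]
    exact hxn (by rw [← hmem, ← hmem, hjj'])
  refine ⟨b 0, hb0, b i, hbi, hlt, fun j x hxb => ?_⟩
  have hbj := hba (b 0) hb0 j
  have hbj' := hlt.le.trans (hba (b i) hbi j)
  have haf := (hj0 j).1
  -- Agreement below `b 0` on all ordinals reduces to agreement on the elements of `F` below `b 0`;
  -- these lie in the root or in `f 0`.
  refine hF.schemeRel_congr h.mem_level h.mem_level hbj hbj' (h.piece_subset h0 haf)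
    (h.piece_subset h0 hbf0) (h.piece_subset hi (hji j).1) (h.piece_subset h0 hbf0)
    (fun y hy hyb => ?_) hxb
  have hpos : finsetPos (f i) (a j (b i)) = p j := (hji j).2.2
  by_cases hyR : y ∈ R
  · rw [hF.schemeRel_root_iff h h0 haf (hj0 j).2.1 hyR,
      hF.schemeRel_root_iff h hi (hji j).1 (hji j).2.1 hyR, hpos]
  obtain ⟨i', hi', hyi'⟩ := h.mem_piece hy
  have hy0 : y ∈ f 0 := by
    rcases Nat.eq_zero_or_pos i' with rfl | hpos'
    · exact hyi'
    · exact absurd hyb (h.pieces_below 0 i' hpos' hi' _ (Finset.mem_sdiff.2 ⟨hbf0, hbR0⟩) _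
        (Finset.mem_sdiff.2 ⟨hyi', hyR⟩)).not_gt
  have hylt : finsetPos (f 0) y < codingType.m l :=
    hF.card_eq l _ (h.piece_mem 0 h0) ▸ finsetPos_lt_card hy0
  -- The table takes positions in `F`; on `f 0`, an initial segment of `F`, they are the positions
  -- in `f 0`.
  have hyF : finsetPos F y = finsetPos (f 0) y := by
    have h2 := h.le_finsetPos_piece h0 hy0 hyR
    rw [h.finsetPos_piece hF h0 hy0 hyR]
    omega
  rw [hF.schemeRel_iff (h.piece_mem 0 h0) haf hy0 (hyb.trans_le hbj),
    hF.schemeRel_iff h.mem_level (h.piece_subset hi (hji j).1) hy (hyb.trans_le hbj'),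
    h.posRel_of_ne hF hi h0 hi0.ne' (hji j).1 (hji j).2.1 hy0 hyR, hcode, hpos, hyF]
  simp only [Finset.mem_filter, Finset.mem_product, Finset.mem_powerset, Finset.mem_range]
  constructor
  · exact fun hrel => ⟨⟨Finset.filter_subset _ _, hylt⟩, j, rfl, hrel⟩
  · rintro ⟨-, j', hj', hrel⟩
    rwa [hinj j j' hj']

end IsConstructionScheme

/-! ### Ranks in trees and tree products -/

namespace IsTreeOrder

variable {T : Type u} [PartialOrder T]

theorem rank_lt_rank (hT : IsTreeOrder T) {x y : T} (hxy : x < y) : hT.rank x < hT.rank y :=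
  have : IsWellFounded T (fun x y => x < y) := ⟨hT.wf⟩
  IsWellFounded.rank_lt_of_rel hxy

theorem exists_lt_rank_eq (hT : IsTreeOrder T) {x : T} {γ : Ordinal.{u}} (hγ : γ < hT.rank x) :
    ∃ y < x, hT.rank y = γ := by
  have : IsWellFounded T (fun x y => x < y) := ⟨hT.wf⟩
  induction hT.wf.apply x with
  | intro x _ ih =>
    have h := hγ
    unfold rank at h
    rw [IsWellFounded.rank_eq, Ordinal.lt_iSup_iff] at h
    obtain ⟨⟨y, hy⟩, h⟩ := h
    rcases (Order.lt_succ_iff.1 h).eq_or_lt with h | h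
    · exact ⟨y, hy, h.symm⟩
    · obtain ⟨z, hz, hzγ⟩ := ih y hy h
      exact ⟨z, hz.trans hy, hzγ⟩

theorem rank_eq_of_strictMono (hT : IsTreeOrder T) {h : T → Ordinal.{u}}
    (hmono : ∀ x y, x < y → h x < h y) (hsurj : ∀ x, ∀ γ < h x, ∃ y < x, h y = γ) (x : T) :
    hT.rank x = h x := by
  have : IsWellFounded T (fun x y => x < y) := ⟨hT.wf⟩
  induction hT.wf.apply x with
  | intro x _ ih =>
    refine le_antisymm (IsWellFounded.rank_le_of_lt hmono x) (le_of_forall_lt fun γ hγ => ?_)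
    obtain ⟨y, hy, rfl⟩ := hsurj x γ hγ
    rw [← ih y hy]
    exact hT.rank_lt_rank hy

theorem lt_trichotomy_of_lt (hT : IsTreeOrder T) {x y z : T} (hx : x < z) (hy : y < z) :
    x < y ∨ x = y ∨ y < x := by
  have := hT z
  rcases trichotomous_of (fun a b : Set.Iio z => a < b) ⟨x, hx⟩ ⟨y, hy⟩ with h | h | h
  · exact Or.inl h
  · exact Or.inr (Or.inl (congrArg Subtype.val h))
  · exact Or.inr (Or.inr h)

theorem le_total_of_le (hT : IsTreeOrder T) {x y z : T} (hx : x ≤ z) (hy : y ≤ z) :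
    x ≤ y ∨ y ≤ x := by
  rcases hx.eq_or_lt with rfl | hx
  · exact Or.inr hy
  rcases hy.eq_or_lt with rfl | hy
  · exact Or.inl hx.le
  rcases hT.lt_trichotomy_of_lt hx hy with h | h | h
  exacts [Or.inl h.le, Or.inl h.le, Or.inr h.le]

theorem lt_of_rank_lt (hT : IsTreeOrder T) {x y z : T} (hx : x < z) (hy : y < z)
    (hxy : hT.rank x < hT.rank y) : x < y := by
  rcases hT.lt_trichotomy_of_lt hx hy with h | h | h
  · exact h
  · exact absurd hxy (h ▸ lt_irrefl _)
  · exact absurd hxy (hT.rank_lt_rank h).not_gt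

theorem eq_of_rank_eq (hT : IsTreeOrder T) {x y z : T} (hx : x < z) (hy : y < z)
    (hxy : hT.rank x = hT.rank y) : x = y := by
  rcases hT.lt_trichotomy_of_lt hx hy with h | h | h
  · exact absurd hxy (hT.rank_lt_rank h).ne
  · exact h
  · exact absurd hxy (hT.rank_lt_rank h).ne'

/-- A partial order is a tree if it has a strictly monotone map to the ordinals and predecessors
of the same element are comparable. -/
theorem of_rank (h : T → Ordinal.{u}) (hmono : ∀ x y, x < y → h x < h y)
    (hcomp : ∀ x y z : T, x < z → y < z → x < y ∨ x = y ∨ y < x) : IsTreeOrder T := by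
  intro t
  refine { wf := ?_, trichotomous := ?_ }
  · exact Subrelation.wf (r := InvImage (· < ·) fun x : Set.Iio t => h x) (fun hxy => hmono _ _ hxy)
      (InvImage.wf _ Ordinal.lt_wf)
  · intro x y hxy hyx
    rcases hcomp x y t x.2 y.2 with h | h | h
    · exact absurd h hxy
    · exact Subtype.ext h
    · exact absurd h hyx

theorem isOmegaOneTree (hT : IsTreeOrder T) (h1 : ∀ x, hT.rank x < Ordinal.omega 1)
    (h2 : ∀ α < Ordinal.omega.{u} 1, (hT.level α).Nonempty)
    (h3 : ∀ α < Ordinal.omega.{u} 1, (hT.level α).Countable) : IsOmegaOneTree T where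
  isTree := hT
  height_eq := by
    have hmem : Ordinal.omega.{u} 1 ∈ {α | hT.level α = ∅} :=
      Set.eq_empty_of_forall_notMem fun x hx => (h1 x).ne hx
    refine le_antisymm (csInf_le' hmem) (le_csInf ⟨_, hmem⟩ fun α hα => ?_)
    by_contra! hlt
    exact (h2 α hlt).ne_empty hα
  countable_level := h3

/-- The cone is closed downwards, because predecessors of one element are comparable. -/
theorem cone_rank (hT : IsTreeOrder T) (t : T) (x : TreeCone t) :
    (hT.cone t).rank x = hT.rank (x : T) := by
  refine (hT.cone t).rank_eq_of_strictMono (h := fun x => hT.rank (x : T))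
    (fun x y hxy => hT.rank_lt_rank hxy) (fun x γ hγ => ?_) x
  obtain ⟨y, hy, hyγ⟩ := hT.exists_lt_rank_eq hγ
  refine ⟨⟨y, ?_⟩, hy, hyγ⟩
  rcases x.2 with h | h
  · exact Or.inl (hy.le.trans h)
  · exact hT.le_total_of_le hy.le h

end IsTreeOrder

namespace TreeProduct

variable {k : ℕ} {T : Fin (k + 1) → Type u} [∀ i, PartialOrder (T i)]
  {hT : ∀ i, IsTreeOrder (T i)}

theorem isTreeOrder : IsTreeOrder (TreeProduct T hT) := by
  refine IsTreeOrder.of_rank (fun x => (hT 0).rank (x.1 0))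
    (fun x y hxy => (hT 0).rank_lt_rank (hxy 0)) fun x y z hx hy => ?_
  have hlt : ∀ x y : TreeProduct T hT, x < z → y < z →
      (hT 0).rank (x.1 0) < (hT 0).rank (y.1 0) → x < y := fun x y hx hy h i =>
    (hT i).lt_of_rank_lt (hx i) (hy i) (by rwa [← x.2 i, ← y.2 i])
  rcases lt_trichotomy ((hT 0).rank (x.1 0)) ((hT 0).rank (y.1 0)) with h | h | h
  · exact Or.inl (hlt x y hx hy h)
  · exact Or.inr (Or.inl (Subtype.ext (funext fun i =>
      (hT i).eq_of_rank_eq (hx i) (hy i) (by rwa [← x.2 i, ← y.2 i]))))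
  · exact Or.inr (Or.inr (hlt y x hy hx h))

theorem rank_eq (h : IsTreeOrder (TreeProduct T hT)) (x : TreeProduct T hT) (i : Fin (k + 1)) :
    h.rank x = (hT i).rank (x.1 i) := by
  rw [← x.2 i]
  refine h.rank_eq_of_strictMono (h := fun x => (hT 0).rank (x.1 0))
    (fun x y hxy => (hT 0).rank_lt_rank (hxy 0)) (fun x γ hγ => ?_) x
  have hex : ∀ i, ∃ y < x.1 i, (hT i).rank y = γ := fun i =>
    (hT i).exists_lt_rank_eq (by rwa [← x.2 i])
  choose y hy hyγ using hex
  exact ⟨⟨y, fun i => by rw [hyγ, hyγ]⟩, hy, hyγ 0⟩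

theorem countable_level (h : IsTreeOrder (TreeProduct T hT)) {α : Ordinal.{u}}
    (hα : ∀ i, ((hT i).level α).Countable) : (h.level α).Countable := by
  have hc := (Set.countable_pi hα).preimage (f := fun x : TreeProduct T hT => x.1)
    Subtype.val_injective
  refine hc.mono fun x hx => ?_
  intro i
  rw [← show h.rank x = α from hx, rank_eq h x i]
  rfl

end TreeProduct

theorem Ordinal.countable_Iic {α : Ordinal.{u}} (hα : α < Ordinal.omega 1) :
    (Set.Iic α).Countable := by
  rw [← Set.Iio_insert]
  refine Set.Countable.insert _ ?_
  rw [Cardinal.lt_omega_iff_card_lt, Cardinal.lt_aleph_one_iff] at hα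
  rw [← Cardinal.le_aleph0_iff_set_countable, Cardinal.mk_Iio_ordinal]
  exact Cardinal.lift_le_aleph0.2 hα

/-- A criterion for full Suslin trees. -/
theorem IsFullSuslin.of_countable {T : Type u} [PartialOrder T] (h : IsOmegaOneTree T)
    (hrank : ∀ x, h.isTree.rank x < Ordinal.omega 1)
    (hext : ∀ t : T, ∀ α < Ordinal.omega.{u} 1, h.isTree.rank t ≤ α →
      ∃ x, t ≤ x ∧ h.isTree.rank x = α)
    (hchain : ∀ C : Set T, IsChain (· ≤ ·) C → C.Countable)
    (hanti : ∀ (k : ℕ) (t : Fin (k + 1) → T), Function.Injective t →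
      (∀ i j, h.isTree.rank (t i) = h.isTree.rank (t j)) → ∀ A : Set (Fin (k + 1) → T),
      (∀ x ∈ A, ∀ i, t i < x i) → (∀ x ∈ A, ∀ i j, h.isTree.rank (x i) = h.isTree.rank (x j)) →
      (∀ x ∈ A, ∀ y ∈ A, ¬ ∀ i, x i < y i) → A.Countable) :
    IsFullSuslin T := by
  refine ⟨h, fun k t ht hrk => ?_⟩
  have hP := TreeProduct.isTreeOrder (hT := fun i => h.isTree.cone (t i))
  have hPrank : ∀ x i, hP.rank x = h.isTree.rank (x.1 i).1 := fun x i => by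
    rw [TreeProduct.rank_eq hP x i, IsTreeOrder.cone_rank]
  have hlev : ∀ α < Ordinal.omega.{u} 1, (hP.level α).Countable := fun α hα => by
    refine TreeProduct.countable_level hP fun i => ?_
    refine ((h.countable_level α hα).preimage Subtype.val_injective).mono fun x hx => ?_
    exact (h.isTree.cone_rank (t i) x).symm.trans hx
  refine ⟨hP.isOmegaOneTree (fun x => hPrank x 0 ▸ hrank _) (fun α hα => ?_) hlev, ?_, ?_⟩
  · rcases le_or_gt (h.isTree.rank (t 0)) α with hle | hlt
    · choose x hx hxα using fun i => hext (t i) α hα (hrk 0 i ▸ hle)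
      refine ⟨⟨fun i => ⟨x i, Or.inr (hx i)⟩, fun i => ?_⟩, ?_⟩
      · rw [h.isTree.cone_rank, h.isTree.cone_rank, hxα, hxα]
      · exact (hPrank _ 0).trans (hxα 0)
    · choose x hx hxα using fun i => h.isTree.exists_lt_rank_eq (x := t i) (hrk 0 i ▸ hlt)
      refine ⟨⟨fun i => ⟨x i, Or.inl (hx i).le⟩, fun i => ?_⟩, ?_⟩
      · rw [h.isTree.cone_rank, h.isTree.cone_rank, hxα, hxα]
      · exact (hPrank _ 0).trans (hxα 0)
  · intro C hC
    have hlt : ∀ x ∈ C, ∀ y ∈ C, x ≠ y → (x.1 0).1 < (y.1 0).1 ∨ (y.1 0).1 < (x.1 0).1 := by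
      intro x hx y hy hne
      rcases hC hx hy hne with (h | h) | (h | h)
      · exact absurd h hne
      · exact Or.inl (h 0)
      · exact absurd h.symm hne
      · exact Or.inr (h 0)
    refine Set.countable_of_injective_of_countable_image (f := fun x => (x.1 0).1) ?_
      (hchain _ ?_)
    · intro x hx y hy hxy
      by_contra hne
      rcases hlt x hx y hy hne with h | h
      · exact h.ne hxy
      · exact h.ne' hxy
    · rintro _ ⟨x, hx, rfl⟩ _ ⟨y, hy, rfl⟩ hne
      exact (hlt x hx y hy fun h => hne (h ▸ rfl)).imp le_of_lt le_of_lt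
  · intro A hA
    let f : (TreeProduct (fun i => TreeCone (t i)) fun i => h.isTree.cone (t i)) →
      Fin (k + 1) → T := fun x i => (x.1 i).1
    have hf : Function.Injective f := fun x y hxy =>
      Subtype.ext (funext fun i => Subtype.ext (congrFun hxy i))
    -- Members of the antichain not above `t` lie in countably many countable levels, so `hanti` is
    -- only needed for tuples strictly above `t`.
    have hlow : (⋃ α ∈ Set.Iic (h.isTree.rank (t 0)), hP.level α).Countable :=
      (Ordinal.countable_Iic (hrank _)).biUnion fun α hα => hlev α (lt_of_le_of_lt hα (hrank _))
    have hhigh : (f '' {x ∈ A | h.isTree.rank (t 0) < hP.rank x}).Countable := by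
      refine hanti k t ht hrk _ ?_ ?_ ?_
      · rintro _ ⟨x, ⟨hx, hlt⟩, rfl⟩ i
        rw [hPrank x i, hrk 0 i] at hlt
        rcases (x.1 i).2 with hle | hle
        · rcases hle.eq_or_lt with he | hl
          · exact absurd hlt (by rw [he]; exact lt_irrefl _)
          · exact absurd hlt (h.isTree.rank_lt_rank hl).not_gt
        · exact lt_of_le_of_ne hle fun he => hlt.ne (congrArg h.isTree.rank he)
      · rintro _ ⟨x, ⟨hx, hlt⟩, rfl⟩ i j
        exact (hPrank x i).symm.trans (hPrank x j)
      · rintro _ ⟨x, ⟨hx, -⟩, rfl⟩ _ ⟨y, ⟨hy, -⟩, rfl⟩ hxy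
        have hlt : x < y := hxy
        exact hA hx hy hlt.ne hlt.le
    refine (hlow.union (Set.countable_of_injective_of_countable_image hf.injOn hhigh)).mono ?_
    intro x hx
    rcases le_or_gt (hP.rank x) (h.isTree.rank (t 0)) with hle | hlt
    · exact Or.inl (Set.mem_biUnion hle rfl)
    · exact Or.inr ⟨hx, hlt⟩

/-! ### The tree of traces -/

/-- The ordinals below `ω₁`, as a type in the lowest universe. -/
abbrev OmegaOne : Type := (Ordinal.omega.{0} 1).ToType

namespace OmegaOne

instance : Nonempty OmegaOne :=
  ⟨Ordinal.ToType.mk ⟨0, Ordinal.omega_pos 1⟩⟩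

/-- The ordinal that corresponds to an element of `OmegaOne`. -/
noncomputable def toOrdinal (x : OmegaOne) : Ordinal.{0} :=
  (Ordinal.ToType.mk.symm x : Set.Iio (Ordinal.omega.{0} 1)).1

theorem toOrdinal_lt (x : OmegaOne) : x.toOrdinal < Ordinal.omega 1 :=
  (Ordinal.ToType.mk.symm x : Set.Iio (Ordinal.omega.{0} 1)).2

theorem toOrdinal_lt_toOrdinal {x y : OmegaOne} : x.toOrdinal < y.toOrdinal ↔ x < y :=
  Ordinal.ToType.mk.symm.lt_iff_lt

theorem toOrdinal_le_toOrdinal {x y : OmegaOne} : x.toOrdinal ≤ y.toOrdinal ↔ x ≤ y :=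
  Ordinal.ToType.mk.symm.le_iff_le

theorem toOrdinal_injective : Function.Injective toOrdinal :=
  Subtype.val_injective.comp Ordinal.ToType.mk.symm.injective

theorem exists_toOrdinal_eq {α : Ordinal.{0}} (hα : α < Ordinal.omega 1) :
    ∃ x : OmegaOne, x.toOrdinal = α :=
  ⟨Ordinal.ToType.mk ⟨α, hα⟩, by simp [toOrdinal]⟩

theorem countable_Iic (b : OmegaOne) : (Set.Iic b).Countable :=
  ((Ordinal.countable_Iic b.toOrdinal_lt).preimage toOrdinal_injective).mono
    fun _ hx => toOrdinal_le_toOrdinal.2 hx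

theorem not_countable_univ : ¬ (Set.univ : Set OmegaOne).Countable := by
  intro h
  refine not_countable_Iio_omega_one ((h.image toOrdinal).mono fun α hα => ?_)
  obtain ⟨x, rfl⟩ := exists_toOrdinal_eq hα
  exact ⟨x, trivial, rfl⟩

theorem exists_isBot : ∃ b : OmegaOne, ∀ x, b ≤ x := by
  obtain ⟨b, hb⟩ := exists_toOrdinal_eq (Ordinal.omega_pos 1)
  exact ⟨b, fun x => toOrdinal_le_toOrdinal.1 (hb ▸ zero_le)⟩

end OmegaOne

/-- `t` is the restriction of a section of `V` to an initial segment of `ω₁`, together with the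
length of this segment. -/
def IsTraceNode (V : OmegaOne → OmegaOne → Prop) (t : OmegaOne × Set OmegaOne) : Prop :=
  ∃ a, t.1 ≤ a ∧ t.2 = {x | x < t.1 ∧ V a x}

/-- `s` is a restriction of `t`. -/
def TraceLE (s t : OmegaOne × Set OmegaOne) : Prop :=
  s.1 ≤ t.1 ∧ s.2 = {x | x < s.1 ∧ x ∈ t.2}

/-- The restriction of `t` to the length `b`. -/
def traceRestrict (t : OmegaOne × Set OmegaOne) (b : OmegaOne) : OmegaOne × Set OmegaOne :=
  (b, {x | x < b ∧ x ∈ t.2})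

theorem TraceLE.mem_iff {s t : OmegaOne × Set OmegaOne} (h : TraceLE s t) {x : OmegaOne}
    (hx : x < s.1) : x ∈ s.2 ↔ x ∈ t.2 := by
  rw [h.2]
  exact and_iff_right hx

theorem TraceLE.trans {s t u : OmegaOne × Set OmegaOne} (h : TraceLE s t) (h' : TraceLE t u) :
    TraceLE s u := by
  refine ⟨h.1.trans h'.1, ?_⟩
  rw [h.2]
  ext x
  exact and_congr_right fun hx => h'.mem_iff (hx.trans_le h.1)

theorem traceLE_traceRestrict {t : OmegaOne × Set OmegaOne} {b : OmegaOne} (hb : b ≤ t.1) :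
    TraceLE (traceRestrict t b) t :=
  ⟨hb, rfl⟩

theorem TraceLE.traceLE_of_le {s t u : OmegaOne × Set OmegaOne} (h : TraceLE s u)
    (h' : TraceLE t u) (hst : s.1 ≤ t.1) : TraceLE s t := by
  refine ⟨hst, ?_⟩
  rw [h.2]
  ext x
  exact and_congr_right fun hx => (h'.mem_iff (hx.trans_le hst)).symm

namespace IsTraceNode

variable {V : OmegaOne → OmegaOne → Prop} {t : OmegaOne × Set OmegaOne}

theorem lt_of_mem (ht : IsTraceNode V t) {x : OmegaOne} (hx : x ∈ t.2) : x < t.1 := by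
  obtain ⟨a, -, h⟩ := ht
  rw [h] at hx
  exact hx.1

theorem traceLE_refl (ht : IsTraceNode V t) : TraceLE t t := by
  refine ⟨le_rfl, ?_⟩
  ext x
  exact ⟨fun hx => ⟨ht.lt_of_mem hx, hx⟩, fun hx => hx.2⟩

theorem traceRestrict (ht : IsTraceNode V t) {b : OmegaOne} (hb : b ≤ t.1) :
    IsTraceNode V (traceRestrict t b) := by
  obtain ⟨a, hta, h⟩ := ht
  refine ⟨a, hb.trans hta, ?_⟩
  ext x
  simp only [_root_.traceRestrict, h, Set.mem_ofPred_eq]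
  exact ⟨fun hx => ⟨hx.1, hx.2.2⟩, fun hx => ⟨hx.1, hx.1.trans_le hb, hx.2⟩⟩

theorem countable_le
    (hV : ∀ b, {s : Set OmegaOne | ∃ a, b ≤ a ∧ s = {x | x < b ∧ V a x}}.Countable)
    (b : OmegaOne) : {t | IsTraceNode V t ∧ t.1 ≤ b}.Countable := by
  refine ((OmegaOne.countable_Iic b).biUnion fun c _ => (hV c).image (Prod.mk c)).mono ?_
  rintro ⟨c, s⟩ ⟨hs, hc⟩
  exact Set.mem_biUnion (show c ∈ Set.Iic b from hc) ⟨s, hs, rfl⟩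

end IsTraceNode

/-- The tree of the traces with uncountably many extensions. -/
def TraceTree (V : OmegaOne → OmegaOne → Prop) : Type :=
  {t // IsTraceNode V t ∧ ¬ {s | IsTraceNode V s ∧ TraceLE t s}.Countable}

/-! ### Order, levels and extensions in the tree of traces -/

namespace TraceTree

variable {V : OmegaOne → OmegaOne → Prop}

instance : PartialOrder (TraceTree V) where
  le s t := TraceLE s.1 t.1
  le_refl s := s.2.1.traceLE_refl
  le_trans _ _ _ h h' := h.trans h'
  le_antisymm s t h h' := by
    have h1 : s.1.1 = t.1.1 := le_antisymm h.1 h'.1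
    refine Subtype.ext (Prod.ext h1 (Set.ext fun x => ⟨fun hx => ?_, fun hx => ?_⟩))
    · exact (h.mem_iff (s.2.1.lt_of_mem hx)).1 hx
    · exact (h'.mem_iff (t.2.1.lt_of_mem hx)).1 hx

theorem le_iff {s t : TraceTree V} : s ≤ t ↔ TraceLE s.1 t.1 := Iff.rfl

theorem lt_of_le_of_lt {s t : TraceTree V} (h : s ≤ t) (h' : s.1.1 < t.1.1) : s < t :=
  lt_of_le_of_ne h fun he => h'.ne (he ▸ rfl)

theorem eq_of_le_of_eq {s t : TraceTree V} (h : s ≤ t) (h' : s.1.1 = t.1.1) : s = t := by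
  refine le_antisymm h (le_iff.2 ⟨h'.ge, ?_⟩)
  ext x
  constructor
  · exact fun hx => ⟨t.2.1.lt_of_mem hx, (h.mem_iff (h' ▸ t.2.1.lt_of_mem hx)).2 hx⟩
  · exact fun hx => (h.mem_iff (h' ▸ hx.1)).1 hx.2

theorem length_lt_length {s t : TraceTree V} (h : s < t) : s.1.1 < t.1.1 :=
  lt_of_le_of_ne h.le.1 fun he => h.ne (eq_of_le_of_eq h.le he)

theorem isTreeOrder : IsTreeOrder (TraceTree V) := by
  refine IsTreeOrder.of_rank (fun t => t.1.1.toOrdinal)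
    (fun s t hst => OmegaOne.toOrdinal_lt_toOrdinal.2 (length_lt_length hst)) fun s t u hs ht => ?_
  rcases lt_trichotomy s.1.1 t.1.1 with h | h | h
  · exact Or.inl (lt_of_le_of_lt (TraceLE.traceLE_of_le hs.le ht.le h.le) h)
  · exact Or.inr (Or.inl (eq_of_le_of_eq (TraceLE.traceLE_of_le hs.le ht.le h.le) h))
  · exact Or.inr (Or.inr (lt_of_le_of_lt (TraceLE.traceLE_of_le ht.le hs.le h.le) h))

theorem rank_eq (h : IsTreeOrder (TraceTree V)) (t : TraceTree V) :
    h.rank t = t.1.1.toOrdinal := by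
  refine h.rank_eq_of_strictMono (h := fun t => t.1.1.toOrdinal)
    (fun s t hst => OmegaOne.toOrdinal_lt_toOrdinal.2 (length_lt_length hst)) (fun t γ hγ => ?_) t
  obtain ⟨b, rfl⟩ := OmegaOne.exists_toOrdinal_eq (hγ.trans t.1.1.toOrdinal_lt)
  have hb := OmegaOne.toOrdinal_lt_toOrdinal.1 hγ
  have hle := traceLE_traceRestrict (t := t.1) hb.le
  refine ⟨⟨traceRestrict t.1 b, t.2.1.traceRestrict hb.le, fun hc => t.2.2 (hc.mono ?_)⟩,
    lt_of_le_of_lt (le_iff.2 hle) hb, rfl⟩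
  exact fun s hs => ⟨hs.1, hle.trans hs.2⟩

theorem countable_length_le
    (hV : ∀ b, {s : Set OmegaOne | ∃ a, b ≤ a ∧ s = {x | x < b ∧ V a x}}.Countable)
    (b : OmegaOne) : {t : TraceTree V | t.1.1 ≤ b}.Countable :=
  ((IsTraceNode.countable_le hV b).preimage (f := fun t : TraceTree V => t.1)
    Subtype.val_injective).mono fun t (ht : t.1.1 ≤ b) => (⟨t.2.1, ht⟩ : IsTraceNode V _ ∧ _)

/-- This is the purpose of keeping only traces with uncountably many extensions. If every extension
of `t` to length `b` had only countably many extensions, then `t` would too, as there are countably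
many traces of length at most `b`. -/
theorem exists_ge
    (hV : ∀ b, {s : Set OmegaOne | ∃ a, b ≤ a ∧ s = {x | x < b ∧ V a x}}.Countable)
    (t : TraceTree V) {b : OmegaOne} (hb : t.1.1 ≤ b) : ∃ x : TraceTree V, t ≤ x ∧ x.1.1 = b := by
  have hc := IsTraceNode.countable_le hV b
  by_contra! hcon
  refine t.2.2 ((hc.union (hc.biUnion (t := fun u _ =>
    {s | (IsTraceNode V s ∧ TraceLE t.1 s) ∧ b ≤ s.1 ∧ traceRestrict s b = u})
    fun u hu => ?_)).mono fun s hs => ?_)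
  · by_contra hunc
    obtain ⟨s, ⟨hs, hts⟩, hbs, rfl⟩ : {s | (IsTraceNode V s ∧ TraceLE t.1 s) ∧ b ≤ s.1 ∧
        traceRestrict s b = u}.Nonempty :=
      Set.nonempty_iff_ne_empty.2 fun he => hunc (he ▸ Set.countable_empty)
    refine hcon ⟨traceRestrict s b, hu.1, fun hc => hunc (hc.mono ?_)⟩ ?_ rfl
    · rintro s' ⟨⟨hs', -⟩, hbs', he⟩
      exact ⟨hs', he ▸ traceLE_traceRestrict hbs'⟩
    · exact le_iff.2 (hts.traceLE_of_le (traceLE_traceRestrict hbs) hb)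
  · rcases le_total s.1 b with hle | hle
    · exact Or.inl ⟨hs.1, hle⟩
    · exact Or.inr (Set.mem_biUnion (show traceRestrict s b ∈ {t | IsTraceNode V t ∧ t.1 ≤ b} from
        ⟨hs.1.traceRestrict hle, le_rfl⟩) ⟨hs, hle, rfl⟩)

theorem exists_length_eq
    (hV : ∀ b, {s : Set OmegaOne | ∃ a, b ≤ a ∧ s = {x | x < b ∧ V a x}}.Countable)
    (b : OmegaOne) : ∃ x : TraceTree V, x.1.1 = b := by
  obtain ⟨m, hm⟩ := OmegaOne.exists_isBot
  -- The empty trace belongs to the tree: it is extended by one trace of each length.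
  have hroot : IsTraceNode V (m, ∅) := ⟨m, le_rfl, by
    ext x
    simp [(hm x).not_gt]⟩
  have hle : ∀ s, TraceLE (m, ∅) s := fun s => ⟨hm _, by
    ext x
    simp [(hm x).not_gt]⟩
  have hunc : ¬ {s | IsTraceNode V s ∧ TraceLE (m, ∅) s}.Countable := by
    intro hc
    refine OmegaOne.not_countable_univ ((hc.image Prod.fst).mono fun b _ => ?_)
    exact ⟨(b, {x | x < b ∧ V b x}), ⟨⟨b, le_rfl, rfl⟩, hle _⟩, rfl⟩
  obtain ⟨x, -, hx⟩ := exists_ge hV (⟨(m, ∅), hroot, hunc⟩ : TraceTree V) (hm b)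
  exact ⟨x, hx⟩

theorem isOmegaOneTree
    (hV : ∀ b, {s : Set OmegaOne | ∃ a, b ≤ a ∧ s = {x | x < b ∧ V a x}}.Countable) :
    IsOmegaOneTree (TraceTree V) := by
  refine isTreeOrder.isOmegaOneTree (fun x => ?_) (fun α hα => ?_) fun α hα => ?_
  · rw [rank_eq]
    exact OmegaOne.toOrdinal_lt _
  · obtain ⟨b, rfl⟩ := OmegaOne.exists_toOrdinal_eq hα
    obtain ⟨x, rfl⟩ := exists_length_eq hV b
    exact ⟨x, rank_eq _ x⟩
  · obtain ⟨b, rfl⟩ := OmegaOne.exists_toOrdinal_eq hα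
    refine (countable_length_le hV b).mono fun x hx => ?_
    have hx : isTreeOrder.rank x = b.toOrdinal := hx
    rw [rank_eq] at hx
    exact (OmegaOne.toOrdinal_injective hx).le

/-- An uncountable chain has for each `b` a member longer than `b`, cut from a section `V (a b)`
with `a b > b`. Comparability would make all these sections agree where `hsplit` finds a
disagreement. -/
theorem countable_chain
    (hV : ∀ b, {s : Set OmegaOne | ∃ a, b ≤ a ∧ s = {x | x < b ∧ V a x}}.Countable)
    (hsplit : ∀ a : OmegaOne → OmegaOne, (∀ b, b < a b) →
      ∃ b b', b < b' ∧ ¬ (V (a b) b ↔ V (a b') b))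
    {C : Set (TraceTree V)} (hC : IsChain (· ≤ ·) C) : C.Countable := by
  by_contra hunc
  have hex : ∀ b : OmegaOne, ∃ x ∈ C, b < x.1.1 := by
    by_contra! h
    obtain ⟨b, hb⟩ := h
    exact hunc ((countable_length_le hV b).mono hb)
  choose x hxC hbx using hex
  choose a hxa hx using fun b => (x b).2.1
  obtain ⟨b, b', hbb', hne⟩ := hsplit a fun b => (hbx b).trans_le (hxa b)
  have hmem : ∀ c, b < (x c).1.1 → (b ∈ (x c).1.2 ↔ V (a c) b) := fun c hc => by
    rw [hx c]
    exact and_iff_right hc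
  rw [← hmem b (hbx b), ← hmem b' (hbb'.trans (hbx b'))] at hne
  rcases hC.total (hxC b) (hxC b') with h | h
  · exact hne (TraceLE.mem_iff h (hbx b))
  · exact hne (TraceLE.mem_iff h (hbb'.trans (hbx b'))).symm

/-- The distinct `t j` of equal length are separated by finitely many points, and these separate the
coordinates of every tuple above `t`. Then `hagree` gives two tuples of different lengths, one
restricting to the other in every coordinate. -/
theorem countable_antichain
    (hV : ∀ b, {s : Set OmegaOne | ∃ a, b ≤ a ∧ s = {x | x < b ∧ V a x}}.Countable) {q : ℕ}
    (hagree : ∀ (B : Set OmegaOne), ¬ B.Countable → ∀ a : Fin q → OmegaOne → OmegaOne,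
      (∀ b ∈ B, ∀ j, b ≤ a j b) → ∀ D : Finset OmegaOne, (∀ x ∈ D, ∀ b ∈ B, x < b) →
      (∀ b ∈ B, ∀ j j', j ≠ j' → ∃ x ∈ D, ¬ (V (a j b) x ↔ V (a j' b) x)) →
      ∃ b ∈ B, ∃ b' ∈ B, b < b' ∧ ∀ j, ∀ x < b, (V (a j b) x ↔ V (a j b') x))
    {t : Fin q → TraceTree V} (ht : Function.Injective t) (htl : ∀ i j, (t i).1.1 = (t j).1.1)
    {A : Set (Fin q → TraceTree V)} (htA : ∀ x ∈ A, ∀ i, t i < x i)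
    (hAl : ∀ x ∈ A, ∃ b, ∀ i, (x i).1.1 = b) (hA : ∀ x ∈ A, ∀ y ∈ A, ¬ ∀ i, x i < y i) :
    A.Countable := by
  classical
  by_contra hunc
  choose! len hlen using hAl
  -- Only countably many tuples have a given length, so uncountably many lengths occur and one tuple
  -- per length suffices.
  have hB : ¬ (len '' A).Countable := by
    intro hB
    refine hunc ((hB.biUnion fun b _ => Set.countable_pi
      (s := fun _ : Fin q => {t : TraceTree V | t.1.1 ≤ b})
      fun _ => countable_length_le hV b).mono fun x hx => ?_)
    exact Set.mem_biUnion (Set.mem_image_of_mem len hx) fun i => (hlen x hx i).le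
  have hx' : ∀ b ∈ len '' A, ∃ x ∈ A, ∀ i, (x i).1.1 = b := by
    rintro _ ⟨x, hx, rfl⟩
    exact ⟨x, hx, hlen x hx⟩
  obtain ⟨x₀, -⟩ : A.Nonempty := Set.nonempty_iff_ne_empty.2 fun he => hunc (he ▸ Set.countable_empty)
  have : Nonempty (Fin q → TraceTree V) := ⟨x₀⟩
  choose! x hxA hxl using hx'
  choose a hxa hx using fun j b => (x b j).2.1
  have hmem : ∀ b ∈ len '' A, ∀ j, ∀ y < b, (y ∈ (x b j).1.2 ↔ V (a j b) y) := by
    intro b hb j y hy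
    rw [hx j b]
    exact and_iff_right (hy.trans_eq (hxl b hb j).symm)
  -- The condition `j ≠ j'` stands under the quantifier so that a point can be chosen for every
  -- pair.
  have hsep : ∀ j j', ∃ y, j ≠ j' → y < (t j).1.1 ∧ ¬ (y ∈ (t j).1.2 ↔ y ∈ (t j').1.2) := by
    intro j j'
    by_contra! hcon
    have hne := (hcon (t j).1.1).1
    refine hne (ht (eq_of_le_of_eq (le_iff.2 ⟨(htl j j').le, ?_⟩) (htl j j')))
    ext y
    constructor
    · exact fun hy => ⟨(t j).2.1.lt_of_mem hy, ((hcon y).2 ((t j).2.1.lt_of_mem hy)).1 hy⟩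
    · exact fun hy => ((hcon y).2 hy.1).2 hy.2
  choose d hd using hsep
  let D : Finset OmegaOne := ((Finset.univ : Finset (Fin q × Fin q)).filter
    fun p => p.1 ≠ p.2).image fun p => d p.1 p.2
  have htb : ∀ b ∈ len '' A, ∀ j, (t j).1.1 < b := fun b hb j =>
    hxl b hb j ▸ length_lt_length (htA _ (hxA b hb) j)
  obtain ⟨b, hb, b', hb', hlt, hag⟩ := hagree _ hB a (fun b hb j => (hxl b hb j).ge.trans (hxa j b)) D (by
      intro y hy b hb
      obtain ⟨p, hp, rfl⟩ := Finset.mem_image.1 hy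
      exact (hd _ _ (Finset.mem_filter.1 hp).2).1.trans (htb b hb _)) (by
      intro b hb j j' hne
      obtain ⟨h1, h2⟩ := hd j j' hne
      refine ⟨d j j', Finset.mem_image.2 ⟨(j, j'), by simpa using hne, rfl⟩, ?_⟩
      rw [← hmem b hb j _ (h1.trans (htb b hb j)), ← hmem b hb j' _ (h1.trans (htb b hb j)),
        ← TraceLE.mem_iff (htA _ (hxA b hb) j).le h1,
        ← TraceLE.mem_iff (htA _ (hxA b hb) j').le (htl j j' ▸ h1)]
      exact h2)
  refine hA _ (hxA b hb) _ (hxA b' hb') fun j => ?_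
  have hll : (x b j).1.1 < (x b' j).1.1 := by rwa [hxl b hb, hxl b' hb']
  refine lt_of_le_of_lt (le_iff.2 ⟨hll.le, ?_⟩) hll
  ext y
  rw [Set.mem_ofPred_eq, hxl b hb j]
  constructor
  · intro hy
    have hyb : y < b := hxl b hb j ▸ (x b j).2.1.lt_of_mem hy
    exact ⟨hyb, (hmem b' hb' j y (hyb.trans hlt)).2 ((hag j y hyb).1 ((hmem b hb j y hyb).1 hy))⟩
  · rintro ⟨hyb, hy⟩
    exact (hmem b hb j y hyb).2 ((hag j y hyb).2 ((hmem b' hb' j y (hyb.trans hlt)).1 hy))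

theorem isFullSuslin
    (hV : ∀ b, {s : Set OmegaOne | ∃ a, b ≤ a ∧ s = {x | x < b ∧ V a x}}.Countable)
    (hsplit : ∀ a : OmegaOne → OmegaOne, (∀ b, b < a b) →
      ∃ b b', b < b' ∧ ¬ (V (a b) b ↔ V (a b') b))
    (hagree : ∀ (q : ℕ) (B : Set OmegaOne), ¬ B.Countable → ∀ a : Fin q → OmegaOne → OmegaOne,
      (∀ b ∈ B, ∀ j, b ≤ a j b) → ∀ D : Finset OmegaOne, (∀ x ∈ D, ∀ b ∈ B, x < b) →
      (∀ b ∈ B, ∀ j j', j ≠ j' → ∃ x ∈ D, ¬ (V (a j b) x ↔ V (a j' b) x)) →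
      ∃ b ∈ B, ∃ b' ∈ B, b < b' ∧ ∀ j, ∀ x < b, (V (a j b) x ↔ V (a j b') x)) :
    IsFullSuslin (TraceTree V) := by
  refine IsFullSuslin.of_countable (isOmegaOneTree hV) (fun x => ?_) (fun t α hα hle => ?_)
    (fun C hC => countable_chain hV hsplit hC) fun k t ht htl A htA hAl hA => ?_
  · rw [rank_eq]
    exact OmegaOne.toOrdinal_lt _
  · obtain ⟨b, rfl⟩ := OmegaOne.exists_toOrdinal_eq hα
    rw [rank_eq, OmegaOne.toOrdinal_le_toOrdinal] at hle
    obtain ⟨x, hx, rfl⟩ := exists_ge hV t hle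
    exact ⟨x, hx, rank_eq _ x⟩
  · simp only [rank_eq, OmegaOne.toOrdinal_injective.eq_iff] at htl hAl
    exact countable_antichain hV (hagree _) ht htl htA
      (fun x hx => ⟨(x 0).1.1, fun i => hAl x hx i 0⟩) hA

end TraceTree

/-! ### The theorem, by transfer of `schemeRel` to `OmegaOne` -/

theorem mainTheorem6 (hFCA : FCA) :
    ∃ (T : Type) (_ : PartialOrder T), IsFullSuslin T := by
  classical
  obtain ⟨𝓕, hF, hcap⟩ := hFCA codingType
  -- A left inverse of `toOrdinal` turns functions on `OmegaOne` into functions on all ordinals; its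
  -- values from `ω₁` on are irrelevant.
  obtain ⟨g, hg⟩ : ∃ g : Ordinal.{0} → OmegaOne, ∀ x : OmegaOne, g x.toOrdinal = x :=
    ⟨Function.invFun OmegaOne.toOrdinal, Function.leftInverse_invFun OmegaOne.toOrdinal_injective⟩
  refine ⟨TraceTree fun a x => schemeRel codingType 𝓕 a.toOrdinal x.toOrdinal, inferInstance,
    TraceTree.isFullSuslin (fun b => ?_) (fun a ha => ?_) fun q B hB a hba D hD hsep => ?_⟩
  · refine ((hF.countable_traces b.toOrdinal).image fun s => OmegaOne.toOrdinal ⁻¹' s).mono ?_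
    rintro _ ⟨a, hba, rfl⟩
    refine ⟨_, ⟨a.toOrdinal, OmegaOne.toOrdinal_le_toOrdinal.2 hba, a.toOrdinal_lt, rfl⟩, ?_⟩
    ext x
    exact and_congr_left fun _ => OmegaOne.toOrdinal_lt_toOrdinal
  · obtain ⟨b, b', hb, hb', hlt, hne⟩ := hF.exists_lt_not_schemeRel_iff hcap
      (fun α => (a (g α)).toOrdinal) (fun α hα => by
        obtain ⟨x, rfl⟩ := OmegaOne.exists_toOrdinal_eq hα
        rw [hg]
        exact OmegaOne.toOrdinal_lt_toOrdinal.2 (ha x)) fun _ _ => OmegaOne.toOrdinal_lt _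
    obtain ⟨b, rfl⟩ := OmegaOne.exists_toOrdinal_eq hb
    obtain ⟨b', rfl⟩ := OmegaOne.exists_toOrdinal_eq hb'
    simp only [hg] at hne
    exact ⟨b, b', OmegaOne.toOrdinal_lt_toOrdinal.1 hlt, hne⟩
  · obtain ⟨_, ⟨b, hb, rfl⟩, _, ⟨b', hb', rfl⟩, hlt, hag⟩ := hF.exists_lt_schemeRel_iff hcap
      (B := OmegaOne.toOrdinal '' B)
      (fun hc => hB (Set.countable_of_injective_of_countable_image
        OmegaOne.toOrdinal_injective.injOn hc))
      (fun j α => (a j (g α)).toOrdinal)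
      (by
        rintro _ ⟨b, hb, rfl⟩ j
        rw [hg]
        exact OmegaOne.toOrdinal_le_toOrdinal.2 (hba b hb j))
      (by
        rintro _ ⟨b, hb, rfl⟩
        exact b.toOrdinal_lt)
      (fun _ _ _ => OmegaOne.toOrdinal_lt _) (D.image OmegaOne.toOrdinal)
      (by
        intro y hy
        obtain ⟨x, hx, rfl⟩ := Finset.mem_image.1 hy
        rintro _ ⟨b, hb, rfl⟩
        exact OmegaOne.toOrdinal_lt_toOrdinal.2 (hD x hx b hb))
      (by
        rintro _ ⟨b, hb, rfl⟩ j j' hne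
        obtain ⟨x, hx, hxn⟩ := hsep b hb j j' hne
        refine ⟨x.toOrdinal, Finset.mem_image_of_mem _ hx, ?_⟩
        rwa [hg])
    simp only [hg] at hag
    exact ⟨b, hb, b', hb', OmegaOne.toOrdinal_lt_toOrdinal.1 hlt, fun j x hx =>
      hag j x.toOrdinal (OmegaOne.toOrdinal_lt_toOrdinal.2 hx)⟩
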